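/- Let $X\subset\mathbb P^4=\mathbb P^4_{\mathbb C}$ be a smooth hypersurface of degree $d\ge 2$, i.e. $X=\{F=0\}$ with $F\in\mathbb C[x_0,\dots,x_4]$ homogeneous of degree $d$ whose partial derivatives have no common zero with $F$ in $\mathbb C^5\setminus\{0\}$; regard $X$ as a complex manifold of dimension $3$. Then for every integer $m\ge 1$ $$H^0(X,E_{2,m}T_X^*)=0,$$ that is, there are no nonzero globally defined (invariant) jet differentials of order $2$ on $X$. Here, for a complex manifold $M$ of dimension $n$, let $J_kM$ be the bundle of $k$-jets of germs of holomorphic curves $f:(\mathbb C,0)\to M$ (two germs have the same $k$-jet if they have the same value at $0$ and, in local holomorphic coordinates, the same derivatives at $0$ up to order $k$). $E_{k,m}T_M^*$ is Demailly's bundle of invariant jet differentials of order $k$ and weighted degree $m$: its global sections are the functions $P:J_kM\to\mathbb C$ which 1. in all local holomorphic coordinates $z=(z_1,\dots,z_n)$ have the form $$P=\sum_{|\alpha_1|+2|\alpha_2|+\dots+k|\alpha_k|=m}R_{\alpha_1,\dots,\alpha_k}(z)\,(dz)^{\alpha_1}(d^2z)^{\alpha_2}\cdots(d^kz)^{\alpha_k}$$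 with holomorphic coefficients $R_{\alpha_1,\dots,\alpha_k}$, where $d^jz_i$ is evaluated on the jet of $f$ as $f_i^{(j)}(0)$; and 2. are invariant under reparametrization: $P\big((f\circ\varphi)',\dots,(f\circ\varphi)^{(k)}\big)=\varphi'(0)^m\,P\big(f',\dots,f^{(k)}\big)$ for every germ of biholomorphism $\varphi$ of $(\mathbb C,0)$. -/

import Mathlib

open scoped Manifold ContDiff

theorem hasFDerivAt_eval {N : ℕ} (F : MvPolynomial (Fin N) ℂ) (v : Fin N → ℂ) :
    HasFDerivAt (fun x : Fin N → ℂ => MvPolynomial.eval x F)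
      (∑ l, MvPolynomial.eval v (MvPolynomial.pderiv l F) •
        ContinuousLinearMap.proj (R := ℂ) (φ := fun _ : Fin N => ℂ) l) v := by
  induction F using MvPolynomial.induction_on with
  | C a =>
    simp only [MvPolynomial.eval_C]
    refine (hasFDerivAt_const (𝕜 := ℂ) a v).congr_fderiv ?_
    ext1 w
    simp
  | add p q hp hq =>
    have h2 : (fun x : Fin N → ℂ => MvPolynomial.eval x (p + q)) =
        (fun x : Fin N → ℂ => MvPolynomial.eval x p) + (fun x => MvPolynomial.eval x q) := by
      ext x; simp
    rw [h2]
    refine (hp.add hq).congr_fderiv ?_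
    ext1 w
    simp [add_mul, Finset.sum_add_distrib]
  | mul_X p i hp =>
    have h := hp.mul (ContinuousLinearMap.hasFDerivAt
      (ContinuousLinearMap.proj (R := ℂ) (φ := fun _ : Fin N => ℂ) i) (x := v))
    have h2 : (fun x : Fin N → ℂ => MvPolynomial.eval x (p * MvPolynomial.X i)) =
      (fun x : Fin N → ℂ => MvPolynomial.eval x p) * (fun x => ContinuousLinearMap.proj (R := ℂ) (φ := fun _ : Fin N => ℂ) i x) := by
      ext x; simp
    rw [h2]
    refine h.congr_fderiv ?_
    ext1 w
    simp [MvPolynomial.pderiv_X, add_mul, Finset.sum_add_distrib, Finset.mul_sum, Pi.single_apply,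
      mul_assoc, apply_ite]

theorem exists_straightening {N : ℕ} (F : MvPolynomial (Fin N) ℂ) (v : Fin N → ℂ) (j : Fin N)
    (hj : MvPolynomial.eval v (MvPolynomial.pderiv j F) ≠ 0) :
    ∃ Ψ : OpenPartialHomeomorph (Fin N → ℂ) (Fin N → ℂ), v ∈ Ψ.source ∧
      (∀ x, Ψ x = Function.update x j (MvPolynomial.eval x F)) ∧
      ContDiffOn ℂ ω Ψ.symm Ψ.target := by
  set g : (Fin N → ℂ) → (Fin N → ℂ) := fun x => Function.update x j (MvPolynomial.eval x F) with hg
  have hFc : ContDiff ℂ ω (fun x : Fin N → ℂ => MvPolynomial.eval x F) := by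
    have := AnalyticOnNhd.eval_mvPolynomial (𝕜 := ℂ) F
    exact contDiffOn_univ.mp (this.contDiffOn uniqueDiffOn_univ)
  have hgc : ContDiff ℂ ω g := by
    rw [contDiff_pi]
    intro l
    by_cases h : l = j
    · subst h; simpa [hg] using hFc
    · simpa [hg, h] using contDiff_apply ℂ ℂ l
  have key : ∀ x, MvPolynomial.eval x (MvPolynomial.pderiv j F) ≠ 0 →
      ∃ A : (Fin N → ℂ) ≃L[ℂ] (Fin N → ℂ), HasFDerivAt g (A : (Fin N → ℂ) →L[ℂ] (Fin N → ℂ)) x := by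
    intro x hx
    set L := ∑ l, MvPolynomial.eval x (MvPolynomial.pderiv l F) •
        ContinuousLinearMap.proj (R := ℂ) (φ := fun _ : Fin N => ℂ) l with hL
    let B : (Fin N → ℂ) →L[ℂ] (Fin N → ℂ) := ContinuousLinearMap.pi fun l =>
      if l = j then L else ContinuousLinearMap.proj (R := ℂ) (φ := fun _ : Fin N => ℂ) l
    have hB : HasFDerivAt g B x := by
      rw [hasFDerivAt_pi]
      intro l
      by_cases h : l = j
      · subst h; simpa [hg] using hasFDerivAt_eval F x
      · simpa [hg, h] using hasFDerivAt_apply l x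
    have hinj : Function.Injective B := by
      rw [injective_iff_map_eq_zero]
      intro w hw
      have h1 : ∀ l, l ≠ j → w l = 0 := fun l hl => by simpa [B, hl] using congrFun hw l
      have h2 : L w = 0 := by simpa [B] using congrFun hw j
      have h3 : L w = MvPolynomial.eval x (MvPolynomial.pderiv j F) * w j := by
        simp only [hL, sum_apply, smul_apply,
          ContinuousLinearMap.proj_apply, smul_eq_mul]
        exact Finset.sum_eq_single j (fun l _ hl => by simp [h1 l hl]) (by simp)
      have h4 : w j = 0 := by
        rw [h3] at h2
        exact (mul_eq_zero.mp h2).resolve_left hx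
      ext l
      by_cases h : l = j
      · rw [h]; exact h4
      · exact h1 l h
    refine ⟨(LinearEquiv.ofInjectiveEndo B.toLinearMap hinj).toContinuousLinearEquiv, ?_⟩
    refine hB.congr_fderiv ?_
    ext1 w
    rfl
  obtain ⟨A, hA⟩ := key v hj
  let Ψ₀ := hgc.contDiffAt.toOpenPartialHomeomorph g hA (by simp)
  have hopen : IsOpen {x : Fin N → ℂ | MvPolynomial.eval x (MvPolynomial.pderiv j F) ≠ 0} :=
    isOpen_ne_fun (MvPolynomial.continuous_eval _) continuous_const
  refine ⟨Ψ₀.restrOpen _ hopen, ?_, fun x => rfl, ?_⟩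
  · exact ⟨hgc.contDiffAt.mem_toOpenPartialHomeomorph_source hA (by simp), hj⟩
  · intro y hy
    have hy' := (Ψ₀.restrOpen _ hopen).map_target hy
    obtain ⟨A', hA'⟩ := key _ hy'.2
    exact ((Ψ₀.restrOpen _ hopen).contDiffAt_symm hy hA' hgc.contDiffAt).contDiffWithinAt

theorem eval_smul_of_isHomogeneous {N d : ℕ} {F : MvPolynomial (Fin N) ℂ} (hF : F.IsHomogeneous d)
    (t : ℂ) (v : Fin N → ℂ) :
    MvPolynomial.eval (t • v) F = t ^ d * MvPolynomial.eval v F := by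
  rw [MvPolynomial.eval_eq, MvPolynomial.eval_eq, Finset.mul_sum]
  refine Finset.sum_congr rfl fun m hm => ?_
  have h : ∑ i ∈ m.support, m i = d := by
    have := hF (MvPolynomial.mem_support_iff.mp hm)
    rw [Finsupp.weight_apply] at this
    simpa [Finsupp.sum] using this
  simp only [Pi.smul_apply, smul_eq_mul, mul_pow, Finset.prod_mul_distrib, Finset.prod_pow_eq_pow_sum, h]
  ring

/-- The quotient topology on complex projective space. -/
noncomputable instance projectivizationTopology (N : ℕ) : TopologicalSpace (Projectivization ℂ (Fin N → ℂ)) :=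
  TopologicalSpace.coinduced (Projectivization.mk' ℂ) inferInstance

theorem isQuotientMap_projMk (N : ℕ) :
    Topology.IsQuotientMap (Projectivization.mk' ℂ : {v : Fin N → ℂ // v ≠ 0} → _) :=
  ⟨⟨rfl⟩, fun p => ⟨⟨p.rep, p.rep_nonzero⟩, p.mk_rep⟩⟩

/-- A smooth hypersurface of degree `d` in `ℙ^{n+1}(ℂ)`, given by a homogeneous equation of
degree `d` whose gradient vanishes at no nonzero zero of the equation. -/
structure SmoothHypersurface (n d : ℕ) where
  poly : MvPolynomial (Fin (n + 2)) ℂ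
  homogeneous : poly.IsHomogeneous d
  smooth : ∀ v : Fin (n + 2) → ℂ, v ≠ 0 → MvPolynomial.eval v poly = 0 →
    ∃ j, MvPolynomial.eval v (MvPolynomial.pderiv j poly) ≠ 0

namespace SmoothHypersurface

/-- The points of the hypersurface: the zero locus of its equation in projective space. -/
def Points {n d : ℕ} (X : SmoothHypersurface n d) : Type :=
  {p : Projectivization ℂ (Fin (n + 2) → ℂ) // MvPolynomial.eval p.rep X.poly = 0}

/-- The topology induced from projective space. -/
noncomputable instance {n d : ℕ} (X : SmoothHypersurface n d) : TopologicalSpace X.Points :=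
  TopologicalSpace.induced Subtype.val inferInstance

/-- Holomorphic affine charts of the hypersurface: the coordinates are `n` of the affine
coordinates `x_l / x_i` of projective space, and the inverse of the chart lifts to a holomorphic
map into `ℂ^{n+2} ∖ {0}`. -/
def IsAffineChart {n d : ℕ} (X : SmoothHypersurface n d)
    (e : OpenPartialHomeomorph X.Points (Fin n → ℂ)) : Prop :=
  (∃ (i : Fin (n + 2)) (s : Fin n → Fin (n + 2)), ∀ p ∈ e.source, p.1.rep i ≠ 0 ∧
      ∀ a, e p a = p.1.rep (s a) / p.1.rep i) ∧
    ∃ σ : (Fin n → ℂ) → (Fin (n + 2) → ℂ), ContDiffOn ℂ ω σ e.target ∧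
      ∀ z ∈ e.target, ∃ h : σ z ≠ 0, (e.symm z).1 = Projectivization.mk ℂ (σ z) h

theorem rep_div_rep {N : ℕ} (v : Fin N → ℂ) (hv : v ≠ 0) (i l : Fin N) :
    (Projectivization.mk ℂ v hv).rep l / (Projectivization.mk ℂ v hv).rep i = v l / v i := by
  obtain ⟨a, ha⟩ := Projectivization.exists_smul_eq_mk_rep ℂ v hv
  rw [← ha]
  have : (a : ℂ) ≠ 0 := a.ne_zero
  simp only [Pi.smul_apply, Units.smul_def, smul_eq_mul]
  exact mul_div_mul_left _ _ this

theorem rep_ne_zero_iff {N : ℕ} (v : Fin N → ℂ) (hv : v ≠ 0) (i : Fin N) :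
    (Projectivization.mk ℂ v hv).rep i ≠ 0 ↔ v i ≠ 0 := by
  obtain ⟨a, ha⟩ := Projectivization.exists_smul_eq_mk_rep ℂ v hv
  rw [← ha]
  simp [Units.smul_def]

theorem eval_rep_mk {n d : ℕ} (X : SmoothHypersurface n d) (v : Fin (n + 2) → ℂ) (hv : v ≠ 0) :
    MvPolynomial.eval (Projectivization.mk ℂ v hv).rep X.poly = 0 ↔
      MvPolynomial.eval v X.poly = 0 := by
  obtain ⟨a, ha⟩ := Projectivization.exists_smul_eq_mk_rep ℂ v hv
  rw [← ha, Units.smul_def, eval_smul_of_isHomogeneous X.homogeneous]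
  simp

theorem isOpen_rep_ne_zero {N : ℕ} (i : Fin N) :
    IsOpen {p : Projectivization ℂ (Fin N → ℂ) | p.rep i ≠ 0} := by
  rw [← (isQuotientMap_projMk N).isOpen_preimage]
  have : (Projectivization.mk' ℂ) ⁻¹' {p : Projectivization ℂ (Fin N → ℂ) | p.rep i ≠ 0} =
      {v : {v : Fin N → ℂ // v ≠ 0} | v.1 i ≠ 0} := by
    ext v
    exact rep_ne_zero_iff v.1 v.2 i
  rw [this]
  exact isOpen_ne_fun ((continuous_apply i).comp continuous_subtype_val) continuous_const

theorem continuousOn_rep_div {N : ℕ} (i : Fin N) :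
    ContinuousOn (fun (p : Projectivization ℂ (Fin N → ℂ)) (l : Fin N) => p.rep l / p.rep i)
      {p | p.rep i ≠ 0} := by
  rw [(isQuotientMap_projMk N).continuousOn_isOpen_iff (isOpen_rep_ne_zero i)]
  have : (fun (p : Projectivization ℂ (Fin N → ℂ)) (l : Fin N) => p.rep l / p.rep i) ∘
      (Projectivization.mk' ℂ) = fun (v : {v : Fin N → ℂ // v ≠ 0}) l => v.1 l / v.1 i := by
    funext v l
    exact rep_div_rep v.1 v.2 i l
  rw [this]
  have hc : ∀ l, Continuous fun v : {v : Fin N → ℂ // v ≠ 0} => v.1 l := fun l =>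
    (continuous_apply l).comp continuous_subtype_val
  refine continuousOn_pi.mpr fun l => ContinuousOn.div (hc l).continuousOn (hc i).continuousOn ?_
  intro v hv
  exact (rep_ne_zero_iff v.1 v.2 i).mp hv

/-- Implicit function theorem: every point of a smooth hypersurface lies in an affine chart. -/
theorem exists_isAffineChart {n d : ℕ} (X : SmoothHypersurface n d) (p : X.Points) :
    ∃ e : OpenPartialHomeomorph X.Points (Fin n → ℂ), X.IsAffineChart e ∧ p ∈ e.source := by
  classical
  obtain ⟨i, hi⟩ : ∃ i, p.1.rep i ≠ 0 := Function.ne_iff.mp p.1.rep_nonzero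
  -- the representative of `p` with `i`-th coordinate one
  set ρ : Projectivization ℂ (Fin (n + 2) → ℂ) → (Fin (n + 2) → ℂ) :=
    fun q l => q.rep l / q.rep i with hρ
  have hρi : ∀ q : Projectivization ℂ (Fin (n + 2) → ℂ), q.rep i ≠ 0 → ρ q i = 1 :=
    fun q hq => div_self hq
  have hρ0 : ∀ q : Projectivization ℂ (Fin (n + 2) → ℂ), q.rep i ≠ 0 → ρ q ≠ 0 := by
    intro q hq h
    have := hρi q hq
    rw [h] at this
    simp at this
  have hρs : ∀ q : Projectivization ℂ (Fin (n + 2) → ℂ), ρ q = (q.rep i)⁻¹ • q.rep := by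
    intro q
    funext l
    simp [hρ, div_eq_inv_mul]
  have hρF : ∀ q : X.Points, MvPolynomial.eval (ρ q.1) X.poly = 0 := by
    intro q
    rw [hρs, eval_smul_of_isHomogeneous X.homogeneous, q.2, mul_zero]
  have hmkρ : ∀ (q : Projectivization ℂ (Fin (n + 2) → ℂ)) (hq : ρ q ≠ 0), q.rep i ≠ 0 →
      Projectivization.mk ℂ (ρ q) hq = q := by
    intro q hq hqi
    conv_rhs => rw [← q.mk_rep]
    rw [Projectivization.mk_eq_mk_iff']
    exact ⟨_, (hρs q).symm⟩
  obtain ⟨j, hji, hj⟩ : ∃ j, j ≠ i ∧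
      MvPolynomial.eval (ρ p.1) (MvPolynomial.pderiv j X.poly) ≠ 0 := by
    by_contra! hcon
    obtain ⟨j, hj⟩ := X.smooth (ρ p.1) (hρ0 _ hi) (hρF p)
    have hji : j = i := by
      by_contra h
      exact hj (hcon j h)
    subst hji
    have hE := congrArg (MvPolynomial.eval (ρ p.1)) X.homogeneous.sum_X_mul_pderiv
    simp only [map_sum, map_mul, MvPolynomial.eval_X, map_nsmul, hρF p, smul_zero] at hE
    rw [Finset.sum_eq_single j (fun l _ hl => by rw [hcon l hl, mul_zero]) (by simp),
      hρi _ hi, one_mul] at hE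
    exact hj hE
  obtain ⟨Ψ, hΨv, hΨ, hΨc⟩ := exists_straightening X.poly (ρ p.1) j hj
  -- the remaining coordinates
  obtain ⟨s⟩ : Nonempty (Fin n ≃ {l : Fin (n + 2) // l ≠ i ∧ l ≠ j}) := by
    refine ⟨(Fintype.equivFinOfCardEq ?_).symm⟩
    rw [Fintype.card_subtype]
    have : (Finset.univ.filter fun l : Fin (n + 2) => l ≠ i ∧ l ≠ j) = Finset.univ \ {i, j} := by
      ext l; simp
    rw [this, Finset.card_sdiff_of_subset (Finset.subset_univ _), Finset.card_pair hji.symm]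
    simp
  let emb : (Fin n → ℂ) → (Fin (n + 2) → ℂ) := fun z l =>
    if h : l ≠ i ∧ l ≠ j then z (s.symm ⟨l, h⟩) else if l = i then 1 else 0
  have hembi : ∀ z, emb z i = 1 := fun z => by simp [emb]
  have hembj : ∀ z, emb z j = 0 := fun z => by simp [emb, hji]
  have hembs : ∀ z a, emb z (s a) = z a := fun z a => by
    have h := (s a).2
    simp only [emb, dif_pos h]
    simp
  have hembc : ContDiff ℂ ω emb := by
    rw [contDiff_pi]
    intro l
    by_cases h : l ≠ i ∧ l ≠ j
    · simp only [emb, dif_pos h]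
      exact contDiff_apply ℂ ℂ _
    · simp only [emb, dif_neg h]
      exact contDiff_const
  have hemb_ext : ∀ z x, x i = 1 → x j = 0 → (∀ a, x (s a) = z a) → emb z = x := by
    intro z x h1 h2 h3
    funext l
    by_cases hli : l = i
    · rw [hli, hembi, h1]
    by_cases hlj : l = j
    · rw [hlj, hembj, h2]
    obtain ⟨a, ha⟩ := s.surjective ⟨l, hli, hlj⟩
    have : l = s a := by rw [ha]
    rw [this, hembs, h3]
  let T : Set (Fin n → ℂ) := emb ⁻¹' Ψ.target
  have hT : IsOpen T := Ψ.open_target.preimage hembc.continuous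
  let σ : (Fin n → ℂ) → (Fin (n + 2) → ℂ) := fun z => Ψ.symm (emb z)
  have hσup : ∀ z ∈ T, Function.update (σ z) j (MvPolynomial.eval (σ z) X.poly) = emb z := by
    intro z hz
    rw [← hΨ]
    exact Ψ.right_inv hz
  have hσi : ∀ z ∈ T, σ z i = 1 := by
    intro z hz
    have := congrFun (hσup z hz) i
    rwa [Function.update_of_ne hji.symm, hembi] at this
  have hσs : ∀ z ∈ T, ∀ a, σ z (s a) = z a := by
    intro z hz a
    have := congrFun (hσup z hz) (s a)
    rwa [Function.update_of_ne (s a).2.2, hembs] at this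
  have hσF : ∀ z ∈ T, MvPolynomial.eval (σ z) X.poly = 0 := by
    intro z hz
    have := congrFun (hσup z hz) j
    rwa [Function.update_self, hembj] at this
  have hσ0 : ∀ z ∈ T, σ z ≠ 0 := by
    intro z hz h
    have := hσi z hz
    rw [h] at this
    simp at this
  have hσc : ContDiffOn ℂ ω σ T := hΨc.comp hembc.contDiffOn (fun z hz => hz)
  let inv : (Fin n → ℂ) → X.Points := fun z =>
    if hz : z ∈ T then ⟨Projectivization.mk ℂ (σ z) (hσ0 z hz),
      (X.eval_rep_mk _ _).mpr (hσF z hz)⟩ else p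
  have hinv : ∀ z (hz : z ∈ T), (inv z).1 = Projectivization.mk ℂ (σ z) (hσ0 z hz) := by
    intro z hz
    have h : inv z = ⟨Projectivization.mk ℂ (σ z) (hσ0 z hz), _⟩ := dif_pos hz
    rw [h]
  have hρmk : ∀ z (hz : z ∈ T), ρ (inv z).1 = σ z := by
    intro z hz
    rw [hinv z hz]
    funext l
    simp only [hρ]
    rw [rep_div_rep, hσi z hz, div_one]
  have hrepi : ∀ z (hz : z ∈ T), (inv z).1.rep i ≠ 0 := by
    intro z hz
    rw [hinv z hz, rep_ne_zero_iff, hσi z hz]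
    exact one_ne_zero
  let S : Set X.Points := {q | q.1.rep i ≠ 0 ∧ ρ q.1 ∈ Ψ.source}
  let f : X.Points → (Fin n → ℂ) := fun q a => ρ q.1 (s a)
  have hembf : ∀ q ∈ S, emb (f q) = Ψ (ρ q.1) := by
    intro q hq
    refine hemb_ext _ _ ?_ ?_ ?_
    · rw [hΨ, Function.update_of_ne hji.symm, hρi _ hq.1]
    · rw [hΨ, Function.update_self, hρF]
    · intro a
      rw [hΨ, Function.update_of_ne (s a).2.2]
  have hfT : ∀ q ∈ S, f q ∈ T := by
    intro q hq
    change emb (f q) ∈ Ψ.target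
    rw [hembf q hq]
    exact Ψ.map_source hq.2
  have hσf : ∀ q ∈ S, σ (f q) = ρ q.1 := by
    intro q hq
    simp only [σ]
    rw [hembf q hq]
    exact Ψ.left_inv hq.2
  have hρcont : ContinuousOn (fun q : X.Points => ρ q.1) {q | q.1.rep i ≠ 0} :=
    (continuousOn_rep_div i).comp continuous_induced_dom.continuousOn (fun q hq => hq)
  have hopen : IsOpen {q : X.Points | q.1.rep i ≠ 0} :=
    (isOpen_rep_ne_zero i).preimage continuous_induced_dom
  have hSsub : S ⊆ {q : X.Points | q.1.rep i ≠ 0} := fun q hq => hq.1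
  let e : OpenPartialHomeomorph X.Points (Fin n → ℂ) :=
    { toFun := f
      invFun := inv
      source := S
      target := T
      map_source' := hfT
      map_target' := fun z hz => by
        refine ⟨hrepi z hz, ?_⟩
        rw [hρmk z hz]
        exact Ψ.map_target hz
      left_inv' := fun q hq => by
        apply Subtype.ext
        rw [hinv _ (hfT q hq)]
        simp only [hσf q hq]
        exact hmkρ q.1 _ hq.1
      right_inv' := fun z hz => by
        funext a
        simp only [f]
        rw [hρmk z hz, hσs z hz]
      open_source := hρcont.isOpen_inter_preimage hopen Ψ.open_source
      open_target := hT
      continuousOn_toFun := continuousOn_pi.mpr fun a =>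
        (continuous_apply (s a : Fin (n + 2))).comp_continuousOn (hρcont.mono hSsub)
      continuousOn_invFun := by
        rw [Topology.IsInducing.continuousOn_iff ⟨rfl⟩, continuousOn_iff_continuous_domRestrict]
        have h1 : Continuous fun z : T => (⟨σ z.1, hσ0 z.1 z.2⟩ : {v : Fin (n + 2) → ℂ // v ≠ 0}) :=
          Continuous.subtype_mk (continuousOn_iff_continuous_domRestrict.mp hσc.continuousOn) _
        have h2 := (isQuotientMap_projMk (n + 2)).continuous.comp h1
        refine h2.congr fun z => ?_
        exact (hinv z.1 z.2).symm }
  refine ⟨e, ⟨⟨i, fun a => s a, fun q hq => ⟨hq.1, fun a => rfl⟩⟩, σ, hσc, fun z hz =>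
    ⟨hσ0 z hz, hinv z hz⟩⟩, hi, hΨv⟩

/-- The hypersurface as a space charted on `ℂ^n` by its affine charts. -/
noncomputable instance {n d : ℕ} (X : SmoothHypersurface n d) :
    ChartedSpace (Fin n → ℂ) X.Points where
  atlas := {e | X.IsAffineChart e}
  chartAt p := (X.exists_isAffineChart p).choose
  mem_chart_source p := (X.exists_isAffineChart p).choose_spec.2
  chart_mem_atlas p := (X.exists_isAffineChart p).choose_spec.1

/-- The hypersurface is a complex manifold. -/
instance {n d : ℕ} (X : SmoothHypersurface n d) :
    IsManifold (modelWithCornersSelf ℂ (Fin n → ℂ)) ω X.Points := by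
  refine isManifold_of_contDiffOn _ _ _ fun e e' he he' => ?_
  obtain ⟨-, σ, hσ, hσe⟩ := he
  obtain ⟨⟨i, s, hs⟩, -⟩ := he'
  simp only [modelWithCornersSelf_coe, modelWithCornersSelf_coe_symm, Function.comp_id,
    Function.id_comp, Set.preimage_id, Set.range_id, Set.inter_univ]
  have key : ∀ z ∈ (e.symm ≫ₕ e').source, σ z i ≠ 0 ∧
      (e.symm ≫ₕ e') z = fun a => σ z (s a) / σ z i := by
    intro z hz
    obtain ⟨hz1, hz2⟩ := (OpenPartialHomeomorph.trans_source e.symm e' ▸ hz :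
      z ∈ e.symm.source ∩ e.symm ⁻¹' e'.source)
    obtain ⟨h0, hmk⟩ := hσe z hz1
    obtain ⟨h1, h2⟩ := hs _ hz2
    refine ⟨?_, ?_⟩
    · rw [hmk, rep_ne_zero_iff] at h1
      exact h1
    · funext a
      rw [OpenPartialHomeomorph.trans_apply, h2, hmk, rep_div_rep]
  have hσ' : ContDiffOn ℂ ω σ (e.symm ≫ₕ e').source := hσ.mono fun z hz =>
    (OpenPartialHomeomorph.trans_source e.symm e' ▸ hz :
      z ∈ e.symm.source ∩ e.symm ⁻¹' e'.source).1
  refine ContDiffOn.congr (f := fun z a => σ z (s a) / σ z i) ?_ fun z hz => (key z hz).2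
  rw [contDiffOn_pi] at hσ' ⊢
  exact fun a => (hσ' (s a)).div (hσ' i) fun z hz => (key z hz).1

end SmoothHypersurface

/-- A holomorphic curve germ `(ℂ, 0) → M` in an `n`-dimensional complex manifold `M`, given by a
representative. -/
structure HolomorphicCurve (n : ℕ) (M : Type*) [TopologicalSpace M]
    [ChartedSpace (Fin n → ℂ) M] where
  toFun : ℂ → M
  holomorphic : ContMDiffAt (modelWithCornersSelf ℂ ℂ) (modelWithCornersSelf ℂ (Fin n → ℂ)) ω
    toFun 0

/-- A germ of biholomorphism of `(ℂ, 0)`, i.e. a local change of parameter fixing the origin. -/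
structure Reparametrization where
  toFun : ℂ → ℂ
  analytic : AnalyticAt ℂ toFun 0
  map_zero : toFun 0 = 0
  deriv_ne_zero : deriv toFun 0 ≠ 0

section Jets

variable {n : ℕ} {M : Type*} [TopologicalSpace M] [ChartedSpace (Fin n → ℂ) M]

/-- The germ `f ∘ φ`. -/
def HolomorphicCurve.reparam (f : HolomorphicCurve n M) (φ : Reparametrization) :
    HolomorphicCurve n M where
  toFun := f.toFun ∘ φ.toFun
  holomorphic := by
    refine ContMDiffAt.comp (I' := modelWithCornersSelf ℂ ℂ) 0 ?_ φ.analytic.contDiffAt.contMDiffAt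
    rw [φ.map_zero]
    exact f.holomorphic

/-- `f_i^{(j)}(0)`: the `j`-th derivative at `0` of the `i`-th component of the curve `f` in the
local coordinates `e`. -/
noncomputable def HolomorphicCurve.jetCoord (f : HolomorphicCurve n M)
    (e : OpenPartialHomeomorph M (Fin n → ℂ)) (j : ℕ) (i : Fin n) : ℂ :=
  iteratedDeriv j (fun t => e (f.toFun t) i) 0

/-- Two germs of curves have the same `k`-jet if they start at the same point and all their
derivatives of order at most `k` in local holomorphic coordinates agree. -/
def jetSetoid (n : ℕ) (M : Type*) [TopologicalSpace M] [ChartedSpace (Fin n → ℂ) M] (k : ℕ) :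
    Setoid (HolomorphicCurve n M) where
  r f g := f.toFun 0 = g.toFun 0 ∧
    ∀ e ∈ IsManifold.maximalAtlas (modelWithCornersSelf ℂ (Fin n → ℂ)) ω M,
      f.toFun 0 ∈ e.source → ∀ j ≤ k, ∀ i, f.jetCoord e j i = g.jetCoord e j i
  iseqv :=
    { refl := fun _ => ⟨rfl, fun _ _ _ _ _ _ => rfl⟩
      symm := fun h => ⟨h.1.symm, fun e he hs j hj i => (h.2 e he (h.1 ▸ hs) j hj i).symm⟩
      trans := fun h h' => ⟨h.1.trans h'.1, fun e he hs j hj i =>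
        (h.2 e he hs j hj i).trans (h'.2 e he (h.1 ▸ hs) j hj i)⟩ }

/-- The total space `J_k M` of the bundle of `k`-jets of germs of holomorphic curves in `M`. -/
def JetSpace (n : ℕ) (M : Type*) [TopologicalSpace M] [ChartedSpace (Fin n → ℂ) M] (k : ℕ) :
    Type _ :=
  Quotient (jetSetoid n M k)

/-- The `k`-jet of a germ of curve. -/
def HolomorphicCurve.jet (f : HolomorphicCurve n M) (k : ℕ) : JetSpace n M k :=
  Quotient.mk (jetSetoid n M k) f

/-- `P` is a holomorphic jet differential of order `k` and weighted degree `m`: in all local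
holomorphic coordinates `z` it is of the form
`∑_{|α₁| + 2|α₂| + ⋯ + k|α_k| = m} R_α(z) dz^{α₁} d²z^{α₂} ⋯ d^k z^{α_k}` with holomorphic
coefficients `R_α`. The variable `(j, i)` of the polynomial stands for `d^{j+1} z_i`. -/
def IsJetDifferential (k m : ℕ) (P : JetSpace n M k → ℂ) : Prop :=
  ∀ e ∈ IsManifold.maximalAtlas (modelWithCornersSelf ℂ (Fin n → ℂ)) ω M,
    ∃ Q : (Fin n → ℂ) → MvPolynomial (Fin k × Fin n) ℂ,
      (∀ z ∈ e.target,
        (Q z).IsWeightedHomogeneous (fun p : Fin k × Fin n => (p.1 : ℕ) + 1) m) ∧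
      (∀ α : Fin k × Fin n →₀ ℕ, AnalyticOnNhd ℂ (fun z => (Q z).coeff α) e.target) ∧
      ∀ f : HolomorphicCurve n M, f.toFun 0 ∈ e.source →
        P (f.jet k) =
          MvPolynomial.eval (fun p => f.jetCoord e ((p.1 : ℕ) + 1) p.2) (Q (e (f.toFun 0)))

/-- `P` is invariant under reparametrization:
`P((f ∘ φ)', …, (f ∘ φ)^{(k)}) = φ'(0)^m P(f', …, f^{(k)})`. -/
def IsReparamInvariant (k m : ℕ) (P : JetSpace n M k → ℂ) : Prop :=
  ∀ (f : HolomorphicCurve n M) (φ : Reparametrization),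
    P ((f.reparam φ).jet k) = deriv φ.toFun 0 ^ m * P (f.jet k)

/-- `H⁰(M, E_{k,m} T_M^*)`: the space of global sections of the bundle of invariant jet
differentials of order `k` and weighted degree `m` on the complex manifold `M`. -/
def globalJetDifferentials (n : ℕ) (M : Type*) [TopologicalSpace M] [ChartedSpace (Fin n → ℂ) M]
    (k m : ℕ) : Submodule ℂ (JetSpace n M k → ℂ) where
  carrier := {P | IsJetDifferential k m P ∧ IsReparamInvariant k m P}
  zero_mem' := by
    refine ⟨fun e _ => ⟨fun _ => 0, fun _ _ => MvPolynomial.isWeightedHomogeneous_zero _ _ _,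
      fun α => ?_, fun f _ => by simp⟩, fun f φ => by simp⟩
    simpa using analyticOnNhd_const
  add_mem' := by
    rintro P P' ⟨h, hi⟩ ⟨h', hi'⟩
    refine ⟨fun e he => ?_, fun f φ => ?_⟩
    · obtain ⟨Q, h1, h2, h3⟩ := h e he
      obtain ⟨Q', h1', h2', h3'⟩ := h' e he
      refine ⟨fun z => Q z + Q' z, fun z hz => (h1 z hz).add (h1' z hz), fun α => ?_,
        fun f hf => ?_⟩
      · simp only [MvPolynomial.coeff_add]
        exact (h2 α).add (h2' α)
      · rw [Pi.add_apply, h3 f hf, h3' f hf, map_add]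
    · rw [Pi.add_apply, Pi.add_apply, hi f φ, hi' f φ, mul_add]
  smul_mem' := by
    rintro c P ⟨h, hi⟩
    refine ⟨fun e he => ?_, fun f φ => ?_⟩
    · obtain ⟨Q, h1, h2, h3⟩ := h e he
      refine ⟨fun z => MvPolynomial.C c * Q z, fun z hz => ?_, fun α => ?_, fun f hf => ?_⟩
      · simpa using (MvPolynomial.isWeightedHomogeneous_C _ c).mul (h1 z hz)
      · simp only [MvPolynomial.coeff_C_mul]
        exact analyticOnNhd_const.mul (h2 α)
      · rw [Pi.smul_apply, h3 f hf, map_mul, MvPolynomial.eval_C, smul_eq_mul]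
    · rw [Pi.smul_apply, Pi.smul_apply, hi f φ, smul_eq_mul, smul_eq_mul, mul_left_comm]

end Jets

/-! The jet differential is lifted to the affine cone and killed along explicit affine curves by a
maximum principle.

Write `F` for the equation. A germ of curve in the hypersurface lifts to the punctured cone, and the
2-jets `(x, y, z)` of such lifts are exactly the solutions of `F = 0`, `dF(y) = 0`, `d²F(y, y) +
dF(z) = 0` with `x ≠ 0`. So `P` becomes a function `G` of cone jets, locally the restriction of
holomorphic functions (`exists_coneJet_function`). Scaling the lift by `a` and the parameter by `μ`
gives `G(a x, a μ y, a μ² z) = μ^m G(x, y, z)`. By compactness, `G` is then at most a constant times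
`r^m` wherever `‖y‖ ≤ r ‖x‖` and `‖z‖ ≤ r² ‖x‖` (`exists_bound_coneJet_function`). As `m ≥ 1`, `G`
tends to zero along any family on which `y` and `z` grow strictly more slowly than `x`.

Such a family passes through every cone jet of a threefold. Among the five coordinates choose `i`
with `x_i ≠ 0` and `j ≠ i` with `∂_j F ≠ 0` at the base point, and let `e`, `a`, `b` be the others.
Move `x` by `s₀` along `e`, `s₁` along `j`, `s₂²` along `a` and `s₃²` along `b`, and move the `j`-th
components of `y` and `z` by `s₂` and `s₃`. The coordinate `x_i` stays fixed, so `x` never vanishes.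
The three cone jet equations in four unknowns cut out a curve near `s = 0`, since their Jacobian
there, completed by `s₀`, is `(∂_j F)³`. When `‖x‖ = t⁴`, the squares force `y, z = O(t²)`, so `r =
O(1/t)` is allowed (`exists_bound_family`).

Elsewhere the solution set may be singular or of larger dimension. This is harmless: multiply a high
power of `G` by the Jacobian determinant. The product vanishes at all bad points and still tends to
zero at infinity, so it is identically zero (`eq_zero_of_tendsto_zero_on_curve`). At `s = 0` the
Jacobian is nonzero, hence `G = 0` there. -/

theorem contDiffAt_omega_iff_analyticAt {E F : Type*} [NormedAddCommGroup E] [NormedSpace ℂ E]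
    [NormedAddCommGroup F] [NormedSpace ℂ F] [CompleteSpace F] {f : E → F} {x : E} :
    ContDiffAt ℂ ω f x ↔ AnalyticAt ℂ f x := by
  rw [← contDiffWithinAt_univ, contDiffWithinAt_omega_iff_analyticWithinAt, analyticWithinAt_univ]

/-! ### Derivatives of a polynomial along a curve -/

section Prolongation

open Filter Topology

variable {N : ℕ}

theorem hasDerivAt_eval_comp (F : MvPolynomial (Fin N) ℂ) {c : ℂ → Fin N → ℂ} {c' : Fin N → ℂ}
    {t : ℂ} (hc : HasDerivAt c c' t) :
    HasDerivAt (fun t => MvPolynomial.eval (c t) F)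
      (∑ l, MvPolynomial.eval (c t) (MvPolynomial.pderiv l F) * c' l) t := by
  have := (hasFDerivAt_eval F (c t)).comp_hasDerivAt t hc
  refine this.congr_deriv ?_
  simp

/-- The first derivative of `F` along a curve with derivatives `y` at `x`. -/
noncomputable def firstProlongation (F : MvPolynomial (Fin N) ℂ) (x y : Fin N → ℂ) : ℂ :=
  ∑ l, MvPolynomial.eval x (MvPolynomial.pderiv l F) * y l

/-- The second derivative of `F` along a curve with derivatives `y`, `z` at `x`. -/
noncomputable def secondProlongation (F : MvPolynomial (Fin N) ℂ) (x y z : Fin N → ℂ) : ℂ :=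
  ∑ l, (firstProlongation (MvPolynomial.pderiv l F) x y * y l +
    MvPolynomial.eval x (MvPolynomial.pderiv l F) * z l)

theorem deriv_eval_comp_eventuallyEq (F : MvPolynomial (Fin N) ℂ) {c : ℂ → Fin N → ℂ}
    (hc : AnalyticAt ℂ c 0) :
    deriv (fun t => MvPolynomial.eval (c t) F) =ᶠ[𝓝 0]
      fun t => firstProlongation F (c t) (deriv c t) := by
  filter_upwards [hc.eventually_analyticAt] with t ht
  exact (hasDerivAt_eval_comp F ht.differentiableAt.hasDerivAt).deriv

theorem deriv_deriv_eval_comp (F : MvPolynomial (Fin N) ℂ) {c : ℂ → Fin N → ℂ}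
    (hc : AnalyticAt ℂ c 0) :
    deriv (deriv fun t => MvPolynomial.eval (c t) F) 0 =
      secondProlongation F (c 0) (deriv c 0) (deriv (deriv c) 0) := by
  rw [(deriv_eval_comp_eventuallyEq F hc).deriv_eq]
  refine HasDerivAt.deriv ?_
  refine HasDerivAt.fun_sum fun l _ => ?_
  have h1 := hasDerivAt_eval_comp (MvPolynomial.pderiv l F) hc.differentiableAt.hasDerivAt
  have h2 := hasDerivAt_pi.mp hc.deriv.differentiableAt.hasDerivAt l
  exact h1.mul h2

end Prolongation

/-! ### Two-jets in the affine cone and lifts of germs of curves -/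

namespace SmoothHypersurface

open Filter Topology

variable {n d : ℕ} (X : SmoothHypersurface n d)

/-- The 2-jets of curves in the punctured affine cone over the hypersurface. -/
def IsConeJet (x y z : Fin (n + 2) → ℂ) : Prop :=
  x ≠ 0 ∧ MvPolynomial.eval x X.poly = 0 ∧ firstProlongation X.poly x y = 0 ∧
    secondProlongation X.poly x y z = 0

/-- The curve `c` in the punctured affine cone lifts the curve `f` in the hypersurface near `0`. -/
structure IsLift (c : ℂ → Fin (n + 2) → ℂ) (f : ℂ → X.Points) : Prop where
  analytic : AnalyticAt ℂ c 0
  lifts : ∀ᶠ t in 𝓝 (0 : ℂ), ∃ h : c t ≠ 0, (f t).1 = Projectivization.mk ℂ (c t) h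

variable {X}

theorem IsLift.eventually_eval_eq_zero {c : ℂ → Fin (n + 2) → ℂ} {f : ℂ → X.Points}
    (h : X.IsLift c f) : ∀ᶠ t in 𝓝 (0 : ℂ), MvPolynomial.eval (c t) X.poly = 0 := by
  filter_upwards [h.lifts] with t ⟨h0, ht⟩
  rw [← X.eval_rep_mk _ h0, ← ht]
  exact (f t).2

/-- The equation vanishes identically along a lift near `0`, so its first two derivatives vanish at
`0`; these are the two prolongations. -/
theorem IsLift.isConeJet {c : ℂ → Fin (n + 2) → ℂ} {f : ℂ → X.Points} (h : X.IsLift c f) :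
    X.IsConeJet (c 0) (deriv c 0) (deriv (deriv c) 0) := by
  have hz : (fun t => MvPolynomial.eval (c t) X.poly) =ᶠ[𝓝 0] fun _ => 0 :=
    h.eventually_eval_eq_zero
  have hz1 : deriv (fun t => MvPolynomial.eval (c t) X.poly) =ᶠ[𝓝 0] fun _ => 0 := by
    filter_upwards [hz.deriv] with t ht
    rw [ht, deriv_const]
  refine ⟨h.lifts.self_of_nhds.1, hz.self_of_nhds, ?_, ?_⟩
  · exact (deriv_eval_comp_eventuallyEq X.poly h.analytic).self_of_nhds.symm.trans
      hz1.self_of_nhds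
  · rw [← deriv_deriv_eval_comp X.poly h.analytic, hz1.deriv_eq, deriv_const]

theorem IsLift.const_smul {c : ℂ → Fin (n + 2) → ℂ} {f : ℂ → X.Points} (h : X.IsLift c f)
    {a : ℂ} (ha : a ≠ 0) : X.IsLift (fun t => a • c t) f := by
  refine ⟨h.analytic.const_smul (c := a), ?_⟩
  filter_upwards [h.lifts] with t ⟨h0, ht⟩
  refine ⟨smul_ne_zero ha h0, ?_⟩
  rw [ht, Projectivization.mk_eq_mk_iff']
  exact ⟨a⁻¹, by simp [smul_smul, ha]⟩

/-- Every germ of curve in the hypersurface lifts to the punctured affine cone. -/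
theorem exists_isLift (f : HolomorphicCurve n X.Points) : ∃ c, X.IsLift c f.toFun := by
  set e := chartAt (Fin n → ℂ) (f.toFun 0) with he
  have hs : f.toFun 0 ∈ e.source := mem_chart_source _ _
  obtain ⟨-, σ, hσ, hσe⟩ : X.IsAffineChart e := chart_mem_atlas (Fin n → ℂ) (f.toFun 0)
  have hf := f.holomorphic
  have hfc := hf.continuousAt
  have hef : AnalyticAt ℂ (fun t => e (f.toFun t)) 0 := by
    rw [contMDiffAt_iff_target] at hf
    have h2 := hf.2
    rw [contMDiffAt_iff_contDiffAt, contDiffAt_omega_iff_analyticAt] at h2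
    simpa [Function.comp_def] using h2
  have hσa : AnalyticAt ℂ σ (e (f.toFun 0)) := by
    rw [← contDiffAt_omega_iff_analyticAt]
    exact hσ.contDiffAt (e.open_target.mem_nhds (e.map_source hs))
  refine ⟨fun t => σ (e (f.toFun t)), hσa.comp (f := fun t => e (f.toFun t)) hef, ?_⟩
  filter_upwards [hfc.eventually_mem (e.open_source.mem_nhds hs)] with t ht
  obtain ⟨h0, h1⟩ := hσe _ (e.map_source ht)
  exact ⟨h0, by rw [← h1, e.left_inv ht]⟩

/-- A curve in the punctured affine cone projects to a germ of curve in the hypersurface. -/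
theorem exists_holomorphicCurve_isLift {c : ℂ → Fin (n + 2) → ℂ} (hc : AnalyticAt ℂ c 0)
    (h0 : c 0 ≠ 0) (hF : ∀ᶠ t in 𝓝 (0 : ℂ), MvPolynomial.eval (c t) X.poly = 0) :
    ∃ f : HolomorphicCurve n X.Points, X.IsLift c f.toFun := by
  classical
  let p₀ : X.Points := ⟨Projectivization.mk ℂ (c 0) h0, (X.eval_rep_mk _ _).mpr hF.self_of_nhds⟩
  -- The value `p₀` off the punctured cone is a filler: only the germ at `0` matters.
  let f : ℂ → X.Points := fun t =>
    if h : c t ≠ 0 ∧ MvPolynomial.eval (c t) X.poly = 0 then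
      ⟨Projectivization.mk ℂ (c t) h.1, (X.eval_rep_mk _ _).mpr h.2⟩ else p₀
  have hne : ∀ᶠ t in 𝓝 (0 : ℂ), c t ≠ 0 := hc.continuousAt.eventually_ne h0
  have hlift : ∀ᶠ t in 𝓝 (0 : ℂ), ∃ h : c t ≠ 0, (f t).1 = Projectivization.mk ℂ (c t) h := by
    filter_upwards [hne, hF] with t h1 h2
    refine ⟨h1, ?_⟩
    have h3 : f t = ⟨Projectivization.mk ℂ (c t) h1, (X.eval_rep_mk _ _).mpr h2⟩ := dif_pos ⟨h1, h2⟩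
    rw [h3]
  have hcont : ContinuousAt f 0 := by
    have hind : Topology.IsInducing
        (fun p : X.Points => (p.1 : Projectivization ℂ (Fin (n + 2) → ℂ))) := ⟨rfl⟩
    rw [hind.continuousAt_iff]
    let u : ℂ → {v : Fin (n + 2) → ℂ // v ≠ 0} := fun t => if h : c t ≠ 0 then ⟨c t, h⟩ else ⟨c 0, h0⟩
    have hu : ContinuousAt u 0 := by
      have hval : Topology.IsInducing (Subtype.val : {v : Fin (n + 2) → ℂ // v ≠ 0} → _) := ⟨rfl⟩
      rw [hval.continuousAt_iff]
      refine hc.continuousAt.congr ?_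
      filter_upwards [hne] with t ht
      simp [u, ht]
    have h1 : ContinuousAt (Projectivization.mk' ℂ ∘ u) 0 :=
      (isQuotientMap_projMk (n + 2)).continuous.continuousAt.comp hu
    refine h1.congr ?_
    filter_upwards [hlift] with t ⟨ht, ht'⟩
    simp only [Function.comp, u]
    rw [ht', dif_pos ht]
    rfl
  refine ⟨⟨f, ?_⟩, hc, hlift⟩
  rw [contMDiffAt_iff_target]
  refine ⟨hcont, ?_⟩
  rw [contMDiffAt_iff_contDiffAt, contDiffAt_omega_iff_analyticAt]
  set e := chartAt (Fin n → ℂ) (f 0) with he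
  have hs : f 0 ∈ e.source := mem_chart_source _ _
  obtain ⟨⟨i, s, hes⟩, -⟩ : X.IsAffineChart e := chart_mem_atlas (Fin n → ℂ) (f 0)
  have hcl : ∀ l, AnalyticAt ℂ (fun t => c t l) 0 := analyticAt_pi_iff.mp hc
  have hci : c 0 i ≠ 0 := by
    obtain ⟨h1, h2⟩ := hlift.self_of_nhds
    have := (hes _ hs).1
    rwa [h2, rep_ne_zero_iff] at this
  -- In an affine chart the projected curve is given by ratios of the coordinates of `c`, which are
  -- holomorphic because `c 0 i ≠ 0`.
  have hq : AnalyticAt ℂ (fun t a => c t (s a) / c t i) 0 :=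
    analyticAt_pi_iff.mpr fun a => (hcl (s a)).div (hcl i) hci
  refine hq.congr ?_
  filter_upwards [hlift, hcont.eventually_mem (e.open_source.mem_nhds hs)] with t ⟨h1, h2⟩ h3
  simp only [Function.comp, mfld_simps]
  funext a
  rw [← he, (hes _ h3).2, h2, rep_div_rep]

/-- Every 2-jet in the cone is the 2-jet of a curve in the cone. -/
theorem IsConeJet.exists_isLift {x y z : Fin (n + 2) → ℂ} (h : X.IsConeJet x y z) :
    ∃ (c : ℂ → Fin (n + 2) → ℂ) (f : HolomorphicCurve n X.Points), X.IsLift c f.toFun ∧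
      c 0 = x ∧ deriv c 0 = y ∧ deriv (deriv c) 0 = z := by
  obtain ⟨hx, hF, hF1, hF2⟩ := h
  obtain ⟨j, hj⟩ := X.smooth x hx hF
  obtain ⟨Ψ, hΨv, hΨ, hΨc⟩ := exists_straightening X.poly x j hj
  -- A quadratic curve has the prescribed 2-jet but need not stay in the cone. In the coordinates of
  -- `Ψ` the cone is the hyperplane where the `j`-th coordinate is `0`, so setting this coordinate
  -- to `0` and applying `Ψ.symm` corrects `τ` in its `j`-th component only.
  let τ : ℂ → Fin (n + 2) → ℂ := fun t => x + t • y + (t ^ 2 / 2) • z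
  let ρ : ℂ → Fin (n + 2) → ℂ := fun t => Function.update (τ t) j 0
  have hτa : AnalyticAt ℂ τ 0 :=
    (analyticAt_const.add (analyticAt_id.smul analyticAt_const)).add
      (((analyticAt_id.pow 2).div analyticAt_const (by norm_num)).smul analyticAt_const)
  have hρa : AnalyticAt ℂ ρ 0 := by
    rw [analyticAt_pi_iff]
    intro l
    by_cases hl : l = j
    · subst hl; simpa [ρ] using analyticAt_const
    · simp only [Function.update_of_ne hl]
      exact analyticAt_pi_iff.mp hτa l
  have hρ0 : ρ 0 = Ψ x := by
    rw [hΨ, hF]; simp [ρ, τ]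
  have hρt : ρ 0 ∈ Ψ.target := by rw [hρ0]; exact Ψ.map_source hΨv
  have hsa : AnalyticAt ℂ Ψ.symm (ρ 0) := by
    rw [← contDiffAt_omega_iff_analyticAt]
    exact hΨc.contDiffAt (Ψ.open_target.mem_nhds hρt)
  let c : ℂ → Fin (n + 2) → ℂ := fun t => Ψ.symm (ρ t)
  have hca : AnalyticAt ℂ c 0 := hsa.comp hρa
  have hc0 : c 0 = x := by simp only [c]; rw [hρ0, Ψ.left_inv hΨv]
  have hup : ∀ᶠ t in 𝓝 (0 : ℂ), Function.update (c t) j (MvPolynomial.eval (c t) X.poly) = ρ t := by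
    filter_upwards [hρa.continuousAt.eventually_mem (Ψ.open_target.mem_nhds hρt)] with t ht
    rw [← hΨ]
    exact Ψ.right_inv ht
  have hcF : ∀ᶠ t in 𝓝 (0 : ℂ), MvPolynomial.eval (c t) X.poly = 0 := by
    filter_upwards [hup] with t ht
    have := congrFun ht j
    simpa [ρ] using this
  have hcl : ∀ l, l ≠ j → (fun t => c t l) =ᶠ[𝓝 0] fun t => x l + t * y l + t ^ 2 / 2 * z l := by
    intro l hl
    filter_upwards [hup] with t ht
    have := congrFun ht l
    simpa [ρ, hl, τ] using this
  obtain ⟨f, hf⟩ := exists_holomorphicCurve_isLift hca (by rw [hc0]; exact hx) hcF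
  obtain ⟨-, -, hc1, hc2⟩ := hf.isConeJet
  rw [hc0] at hc1 hc2
  have hd1 : ∀ t l, AnalyticAt ℂ c t → deriv c t l = deriv (fun t => c t l) t := fun t l ht =>
    (hasDerivAt_pi.mp ht.differentiableAt.hasDerivAt l).deriv.symm
  have hd2 : ∀ l, deriv (deriv c) 0 l = deriv (deriv fun t => c t l) 0 := by
    intro l
    rw [← (hasDerivAt_pi.mp hca.deriv.differentiableAt.hasDerivAt l).deriv]
    refine EventuallyEq.deriv_eq ?_
    filter_upwards [hca.eventually_analyticAt] with t ht using hd1 t l ht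
  have hpoly : ∀ a b e t : ℂ, HasDerivAt (fun t : ℂ => a + t * b + t ^ 2 / 2 * e) (b + t * e) t := by
    intro a b e t
    have h1 := (((hasDerivAt_id t).mul_const b).const_add a).add
      ((((hasDerivAt_id t).pow 2).div_const 2).mul_const e)
    refine h1.congr_deriv ?_
    simp
  have hyl : ∀ l, l ≠ j → deriv c 0 l = y l := by
    intro l hl
    rw [hd1 0 l hca, (hcl l hl).deriv_eq, (hpoly _ _ _ 0).deriv]
    simp
  have hzl : ∀ l, l ≠ j → deriv (deriv c) 0 l = z l := by
    intro l hl
    rw [hd2, (hcl l hl).deriv.deriv_eq]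
    have : deriv (fun t : ℂ => x l + t * y l + t ^ 2 / 2 * z l) = fun t => y l + t * z l := by
      funext t; exact (hpoly _ _ _ t).deriv
    rw [this]
    simp
  have hy : deriv c 0 = y := by
    funext l
    by_cases hl : l = j
    · subst hl
      -- The `j`-th component is recovered from the equation: `deriv c 0` and `y` solve the same
      -- linear equation, agree in all other components, and `∂_j F ≠ 0`.
      have h1 := hc1.trans hF1.symm
      simp only [firstProlongation] at h1
      rw [← Finset.add_sum_erase _ _ (Finset.mem_univ l),
        ← Finset.add_sum_erase Finset.univ (fun k => _ * y k) (Finset.mem_univ l),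
        Finset.sum_congr rfl fun k hk => by rw [hyl k (Finset.ne_of_mem_erase hk)]] at h1
      exact mul_left_cancel₀ hj (add_right_cancel h1)
    · exact hyl l hl
  have hz : deriv (deriv c) 0 = z := by
    funext l
    by_cases hl : l = j
    · subst hl
      -- Once the velocities agree, the quadratic parts of the second prolongation cancel, and the
      -- same argument applies to `z`.
      rw [hy] at hc2
      have h1 := hc2.trans hF2.symm
      simp only [secondProlongation, Finset.sum_add_distrib] at h1
      replace h1 := add_left_cancel h1
      rw [← Finset.add_sum_erase _ _ (Finset.mem_univ l),
        ← Finset.add_sum_erase Finset.univ (fun k => _ * z k) (Finset.mem_univ l),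
        Finset.sum_congr rfl fun k hk => by rw [hzl k (Finset.ne_of_mem_erase hk)]] at h1
      exact mul_left_cancel₀ hj (add_right_cancel h1)
    · exact hzl l hl
  exact ⟨c, f, hf, hc0, hy, hz⟩

end SmoothHypersurface

/-! ### A maximum principle on affine curves with singularities -/

section MaximumPrinciple

open Filter Topology

/-- The Jacobian determinant of a polynomial self-map of affine space. -/
noncomputable def jacobianDet {n : ℕ} (Φ : Fin n → MvPolynomial (Fin n) ℂ) :
    MvPolynomial (Fin n) ℂ :=
  (Matrix.of fun k l => MvPolynomial.pderiv l (Φ k)).det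

theorem eval_jacobianDet {n : ℕ} (Φ : Fin n → MvPolynomial (Fin n) ℂ) (v : Fin n → ℂ) :
    MvPolynomial.eval v (jacobianDet Φ) =
      (Matrix.of fun k l => MvPolynomial.eval v (MvPolynomial.pderiv l (Φ k))).det := by
  rw [jacobianDet, RingHom.map_det]
  rfl

/-- Inverse function theorem: where the Jacobian determinant does not vanish, one component of a
polynomial map is a local parameter on the common level set of the other components. -/
theorem exists_analytic_disc {n : ℕ} (Φ : Fin n → MvPolynomial (Fin n) ℂ) (k₀ : Fin n)
    (v : Fin n → ℂ) (hv : MvPolynomial.eval v (jacobianDet Φ) ≠ 0) :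
    ∃ γ : ℂ → Fin n → ℂ, AnalyticAt ℂ γ 0 ∧ γ 0 = v ∧ ∀ᶠ s in 𝓝 (0 : ℂ),
      (∀ k, k ≠ k₀ → MvPolynomial.eval (γ s) (Φ k) = MvPolynomial.eval v (Φ k)) ∧
      MvPolynomial.eval (γ s) (Φ k₀) = MvPolynomial.eval v (Φ k₀) + s := by
  set g : (Fin n → ℂ) → (Fin n → ℂ) := fun x k => MvPolynomial.eval x (Φ k) with hg
  have hgc : ContDiff ℂ ω g := by
    rw [contDiff_pi]
    intro k
    have := AnalyticOnNhd.eval_mvPolynomial (𝕜 := ℂ) (Φ k)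
    exact contDiffOn_univ.mp (this.contDiffOn uniqueDiffOn_univ)
  rw [eval_jacobianDet] at hv
  set A := Matrix.of fun k l => MvPolynomial.eval v (MvPolynomial.pderiv l (Φ k)) with hA
  let B : (Fin n → ℂ) →L[ℂ] (Fin n → ℂ) := LinearMap.toContinuousLinearMap A.mulVecLin
  have hB : HasFDerivAt g B v := by
    rw [hasFDerivAt_pi']
    intro k
    refine (hasFDerivAt_eval (Φ k) v).congr_fderiv ?_
    ext1 w
    simp [B, hA, Matrix.mulVec, dotProduct]
  have hinj : Function.Injective B :=
    Matrix.mulVec_injective_iff_isUnit.mpr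
      ((Matrix.isUnit_iff_isUnit_det _).mpr (isUnit_iff_ne_zero.mpr hv))
  let B' : (Fin n → ℂ) ≃L[ℂ] (Fin n → ℂ) :=
    (LinearEquiv.ofInjectiveEndo B.toLinearMap hinj).toContinuousLinearEquiv
  have hB' : HasFDerivAt g (B' : (Fin n → ℂ) →L[ℂ] (Fin n → ℂ)) v := by
    refine hB.congr_fderiv ?_
    ext1 w
    rfl
  let Ψ := hgc.contDiffAt.toOpenPartialHomeomorph g hB' (by simp)
  have hvs : v ∈ Ψ.source := hgc.contDiffAt.mem_toOpenPartialHomeomorph_source hB' (by simp)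
  have hgv : g v ∈ Ψ.target := Ψ.map_source hvs
  have hsymm : Ψ.symm (g v) = v := Ψ.left_inv hvs
  -- A line in the target on which only the `k₀`-th value varies; its preimage under the local
  -- inverse is the disc.
  let δ : ℂ → Fin n → ℂ := fun s => g v + s • Pi.single k₀ 1
  have hδ0 : δ 0 = g v := by simp [δ]
  have hδ : AnalyticAt ℂ δ 0 := by
    refine analyticAt_const.add ?_
    exact (analyticAt_id.smul analyticAt_const)
  have hsa : AnalyticAt ℂ Ψ.symm (δ 0) := by
    rw [hδ0, ← contDiffAt_omega_iff_analyticAt]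
    refine Ψ.contDiffAt_symm hgv (f₀' := B') ?_ hgc.contDiffAt
    rw [hsymm]
    exact hB'
  refine ⟨fun s => Ψ.symm (δ s), hsa.comp hδ, (congrArg Ψ.symm hδ0).trans hsymm, ?_⟩
  have hmem : ∀ᶠ s in 𝓝 (0 : ℂ), δ s ∈ Ψ.target :=
    hδ.continuousAt.eventually_mem (by rw [hδ0]; exact Ψ.open_target.mem_nhds hgv)
  filter_upwards [hmem] with s hs
  have h : g (Ψ.symm (δ s)) = δ s := Ψ.right_inv hs
  refine ⟨fun k hk => ?_, ?_⟩
  · have := congrFun h k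
    simpa [δ, hg, hk] using this
  · have := congrFun h k₀
    simpa [δ, hg] using this

/-- Maximum principle on a possibly singular affine curve: a function which is locally the
restriction of holomorphic functions, tends to zero at infinity and vanishes at the singular points
vanishes identically. -/
theorem eq_zero_of_tendsto_zero_on_curve {n : ℕ} (Φ : Fin n → MvPolynomial (Fin n) ℂ) (k₀ : Fin n)
    (h : (Fin n → ℂ) → ℂ)
    (hloc : ∀ v, (∀ k, k ≠ k₀ → MvPolynomial.eval v (Φ k) = 0) →
      ∃ H : (Fin n → ℂ) → ℂ, AnalyticAt ℂ H v ∧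
        ∀ᶠ w in 𝓝 v, (∀ k, k ≠ k₀ → MvPolynomial.eval w (Φ k) = 0) → h w = H w)
    (hsing : ∀ v, (∀ k, k ≠ k₀ → MvPolynomial.eval v (Φ k) = 0) →
      MvPolynomial.eval v (jacobianDet Φ) = 0 → h v = 0)
    (hdecay : ∀ ε > 0, ∃ R : ℝ, ∀ v, (∀ k, k ≠ k₀ → MvPolynomial.eval v (Φ k) = 0) →
      R < ‖v‖ → ‖h v‖ < ε)
    (v₀ : Fin n → ℂ) (hv₀ : ∀ k, k ≠ k₀ → MvPolynomial.eval v₀ (Φ k) = 0) : h v₀ = 0 := by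
  by_contra hne
  set V : Set (Fin n → ℂ) := {v | ∀ k, k ≠ k₀ → MvPolynomial.eval v (Φ k) = 0} with hV
  have hVc : IsClosed V := by
    have : V = ⋂ k, ⋂ (_ : k ≠ k₀), {v | MvPolynomial.eval v (Φ k) = 0} := by
      ext v; simp [hV]
    rw [this]
    exact isClosed_iInter fun k => isClosed_iInter fun _ =>
      isClosed_eq (MvPolynomial.continuous_eval _) continuous_const
  have hcont : ContinuousOn h V := by
    intro v hv
    obtain ⟨H, hH, heq⟩ := hloc v hv
    refine hH.continuousAt.continuousWithinAt.congr_of_eventuallyEq ?_ (heq.self_of_nhds hv)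
    rw [EventuallyEq, eventually_nhdsWithin_iff]
    exact heq
  -- Points where `h` is at least as large as at `v₀` lie in a fixed ball, so the maximum of `‖h‖`
  -- on the closed set `V` is attained.
  obtain ⟨R, hR⟩ := hdecay ‖h v₀‖ (norm_pos_iff.mpr hne)
  have hKc : IsCompact (V ∩ Metric.closedBall 0 R) :=
    (isCompact_closedBall _ _).inter_left hVc
  have hball : ∀ v ∈ V, ‖h v₀‖ ≤ ‖h v‖ → v ∈ Metric.closedBall (0 : Fin n → ℂ) R := by
    intro v hv hle
    rw [mem_closedBall_zero_iff]
    by_contra! hlt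
    exact absurd (hR v hv hlt) (not_lt.mpr hle)
  obtain ⟨v₁, hv₁, hmax⟩ := hKc.exists_isMaxOn ⟨v₀, hv₀, hball v₀ hv₀ le_rfl⟩
    ((hcont.mono Set.inter_subset_left).norm)
  have hmax' : ∀ v ∈ V, ‖h v‖ ≤ ‖h v₁‖ := by
    intro v hv
    by_cases hle : ‖h v₀‖ ≤ ‖h v‖
    · exact hmax ⟨hv, hball v hv hle⟩
    · exact (not_le.mp hle).le.trans (hmax ⟨hv₀, hball v₀ hv₀ le_rfl⟩)
  have hpos : 0 < ‖h v₁‖ := (norm_pos_iff.mpr hne).trans_le (hmax' v₀ hv₀)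
  -- The set of all maximum points is compact. Choosing in it a point where `Re Φ k₀` is largest
  -- makes a purely local contradiction possible, without any propagation along components of `V`.
  set K : Set (Fin n → ℂ) := (V ∩ Metric.closedBall 0 R) ∩ {v | ‖h v₁‖ ≤ ‖h v‖} with hK
  have hKcomp : IsCompact K := by
    refine hKc.of_isClosed_subset ?_ Set.inter_subset_left
    exact (hcont.mono Set.inter_subset_left).norm.preimage_isClosed_of_isClosed hKc.isClosed
      isClosed_Ici
  obtain ⟨v₂, hv₂, hre⟩ := hKcomp.exists_isMaxOn ⟨v₁, hv₁, le_refl ‖h v₁‖⟩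
    (f := fun v => (MvPolynomial.eval v (Φ k₀)).re)
    (Complex.continuous_re.comp (MvPolynomial.continuous_eval _)).continuousOn
  have hv₂V : v₂ ∈ V := hv₂.1.1
  -- `h` vanishes at the bad points and its maximum modulus is positive, so `v₂` is a good point.
  have hq : MvPolynomial.eval v₂ (jacobianDet Φ) ≠ 0 := by
    intro h0
    have h1 : ‖h v₁‖ ≤ ‖h v₂‖ := hv₂.2
    rw [hsing v₂ hv₂V h0, norm_zero] at h1
    exact absurd h1 (not_le.mpr hpos)
  obtain ⟨γ, hγ, hγ0, hγV⟩ := exists_analytic_disc Φ k₀ v₂ hq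
  obtain ⟨H, hH, heq⟩ := hloc v₂ hv₂V
  have hγmem : ∀ᶠ s in 𝓝 (0 : ℂ), γ s ∈ V := by
    filter_upwards [hγV] with s hs k hk
    rw [hs.1 k hk, hv₂V k hk]
  have hHγ : AnalyticAt ℂ (fun s => H (γ s)) 0 := by
    refine AnalyticAt.comp (g := H) ?_ hγ
    rw [hγ0]; exact hH
  have heqγ : ∀ᶠ s in 𝓝 (0 : ℂ), h (γ s) = H (γ s) := by
    have ht : Tendsto γ (𝓝 0) (𝓝 v₂) := by
      have := hγ.continuousAt.tendsto
      rwa [hγ0] at this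
    filter_upwards [ht.eventually heq, hγmem] with s hs hs'
    exact hs hs'
  have hh0 : H (γ 0) = h v₂ := by rw [← heqγ.self_of_nhds, hγ0]
  have hlocmax : IsLocalMax (norm ∘ fun s => H (γ s)) 0 := by
    filter_upwards [heqγ, hγmem] with s hs hs'
    simp only [Function.comp]
    rw [← hs, hh0]
    exact (hmax' _ hs').trans hv₂.2
  have hconst := Complex.norm_eventually_eq_of_isLocalMax
    (hHγ.eventually_analyticAt.mono fun s hs => hs.differentiableAt) hlocmax
  -- By the maximum modulus principle `‖h‖` is constant on the disc, so the disc stays in `K`; but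
  -- `Φ k₀` is a parameter on it, and its real part increases for small positive `s`.
  have hfinal : ∀ᶠ s in 𝓝 (0 : ℂ), (MvPolynomial.eval v₂ (Φ k₀)).re + s.re ≤
      (MvPolynomial.eval v₂ (Φ k₀)).re := by
    filter_upwards [hconst, heqγ, hγmem, hγV] with s h1 h2 h3 h4
    have h5 : ‖h v₁‖ ≤ ‖h (γ s)‖ := by
      rw [h2, h1, hh0]
      exact hv₂.2
    have h6 : γ s ∈ K := ⟨⟨h3, hball _ h3 ((hmax' v₀ hv₀).trans h5)⟩, h5⟩
    have h7 := hre h6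
    simp only [Set.mem_ofPred_eq] at h7
    rwa [h4.2, Complex.add_re] at h7
  obtain ⟨r, hr, hball'⟩ := Metric.eventually_nhds_iff.mp hfinal
  have := hball' (y := ((r / 2 : ℝ) : ℂ)) (by
    rw [dist_zero_right, Complex.norm_real, Real.norm_eq_abs, abs_of_pos (by positivity)]
    linarith)
  rw [Complex.ofReal_re] at this
  linarith

/-- Polynomial growth of polynomials. -/
theorem exists_norm_eval_le {n : ℕ} (p : MvPolynomial (Fin n) ℂ) :
    ∃ (C : ℝ) (D : ℕ), 0 ≤ C ∧ ∀ v, ‖MvPolynomial.eval v p‖ ≤ C * (1 + ‖v‖) ^ D := by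
  induction p using MvPolynomial.induction_on with
  | C a => exact ⟨‖a‖, 0, norm_nonneg _, fun v => by simp⟩
  | add p q hp hq =>
    obtain ⟨C, D, hC, h⟩ := hp
    obtain ⟨C', D', hC', h'⟩ := hq
    refine ⟨C + C', D + D', add_nonneg hC hC', fun v => ?_⟩
    have h1 : (1 : ℝ) ≤ 1 + ‖v‖ := by simp
    rw [map_add, add_mul]
    refine (norm_add_le _ _).trans (add_le_add ((h v).trans ?_) ((h' v).trans ?_))
    · exact mul_le_mul_of_nonneg_left (pow_le_pow_right₀ h1 (Nat.le_add_right _ _)) hC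
    · exact mul_le_mul_of_nonneg_left (pow_le_pow_right₀ h1 (Nat.le_add_left _ _)) hC'
  | mul_X p i hp =>
    obtain ⟨C, D, hC, h⟩ := hp
    refine ⟨C, D + 1, hC, fun v => ?_⟩
    rw [map_mul, MvPolynomial.eval_X, norm_mul, pow_succ, ← mul_assoc]
    refine mul_le_mul (h v) ?_ (norm_nonneg _) (by positivity)
    exact (norm_le_pi_norm v i).trans (by simp)

end MaximumPrinciple

/-- Evaluation of a weighted homogeneous polynomial as a sum over a fixed finite set of monomials. -/
theorem eval_eq_sum_Iic_of_isWeightedHomogeneous {ι : Type*} [Fintype ι] [DecidableEq ι]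
    {w : ι → ℕ} (hw : ∀ p, 1 ≤ w p)
    {m : ℕ} {Q : MvPolynomial ι ℂ} (hQ : Q.IsWeightedHomogeneous w m) (ρ : ι → ℂ) :
    MvPolynomial.eval ρ Q =
      ∑ α ∈ Finset.Iic (Finsupp.equivFunOnFinite.symm fun _ : ι => m),
        Q.coeff α * ∏ p, ρ p ^ α p := by
  rw [MvPolynomial.eval_eq']
  refine Finset.sum_subset (fun α hα => ?_) fun α _ hα => ?_
  · rw [Finset.mem_Iic]
    intro p
    have h1 := hQ (MvPolynomial.mem_support_iff.mp hα)
    rw [Finsupp.weight_apply, Finsupp.sum_fintype _ _ (fun _ => by simp)] at h1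
    rw [Finsupp.coe_equivFunOnFinite_symm, ← h1]
    calc α p ≤ α p • w p := Nat.le_mul_of_pos_right _ (hw p)
      _ ≤ _ := Finset.single_le_sum (f := fun p => α p • w p) (fun _ _ => Nat.zero_le _)
        (Finset.mem_univ p)
  · rw [MvPolynomial.notMem_support_iff.mp hα, zero_mul]

/-! ### Jet differentials as functions of cone jets -/

theorem deriv_div_eventuallyEq {u w : ℂ → ℂ} (hu : AnalyticAt ℂ u 0) (hw : AnalyticAt ℂ w 0)
    (h0 : w 0 ≠ 0) : deriv (fun t => u t / w t) =ᶠ[nhds 0]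
      fun t => (deriv u t * w t - u t * deriv w t) / w t ^ 2 := by
  filter_upwards [hu.eventually_analyticAt, hw.eventually_analyticAt,
    hw.continuousAt.eventually_ne h0] with t h1 h2 h3
  exact deriv_fun_div h1.differentiableAt h2.differentiableAt h3

theorem deriv_deriv_div {u w : ℂ → ℂ} (hu : AnalyticAt ℂ u 0) (hw : AnalyticAt ℂ w 0)
    (h0 : w 0 ≠ 0) : deriv (deriv fun t => u t / w t) 0 =
      ((deriv (deriv u) 0 * w 0 - u 0 * deriv (deriv w) 0) * w 0 -
        2 * deriv w 0 * (deriv u 0 * w 0 - u 0 * deriv w 0)) / w 0 ^ 3 := by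
  rw [(deriv_div_eventuallyEq hu hw h0).deriv_eq]
  have hu' := hu.differentiableAt.hasDerivAt
  have hw' := hw.differentiableAt.hasDerivAt
  have h := (((hu.deriv.differentiableAt.hasDerivAt.mul hw').sub
    (hu'.mul hw.deriv.differentiableAt.hasDerivAt)).div (hw'.pow 2) (pow_ne_zero 2 h0)).deriv
  refine Eq.trans h ?_
  simp only [Pi.pow_apply, Pi.mul_apply, Pi.sub_apply]
  field_simp
  push_cast
  ring

namespace SmoothHypersurface

open Filter Topology

variable {n d : ℕ} {X : SmoothHypersurface n d}

/-- The 2-jet at `0` of a curve in affine space. -/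
noncomputable def curveJet {N : ℕ} (c : ℂ → Fin N → ℂ) :
    (Fin N → ℂ) × (Fin N → ℂ) × (Fin N → ℂ) :=
  (c 0, deriv c 0, deriv (deriv c) 0)

/-- The derivatives of order `p.1 + 1` of the quotients `x_{s a} / x_i` in terms of a 2-jet. -/
noncomputable def affineJet {N n : ℕ} (i : Fin N) (s : Fin n → Fin N) (p : Fin 2 × Fin n)
    (v : (Fin N → ℂ) × (Fin N → ℂ) × (Fin N → ℂ)) : ℂ :=
  if p.1 = 0 then (v.2.1 (s p.2) * v.1 i - v.1 (s p.2) * v.2.1 i) / v.1 i ^ 2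
  else ((v.2.2 (s p.2) * v.1 i - v.1 (s p.2) * v.2.2 i) * v.1 i -
        2 * v.2.1 i * (v.2.1 (s p.2) * v.1 i - v.1 (s p.2) * v.2.1 i)) / v.1 i ^ 3

theorem analyticAt_affineJet {N n : ℕ} (i : Fin N) (s : Fin n → Fin N) (p : Fin 2 × Fin n)
    {v : (Fin N → ℂ) × (Fin N → ℂ) × (Fin N → ℂ)} (hv : v.1 i ≠ 0) :
    AnalyticAt ℂ (affineJet i s p) v := by
  have h1 : ∀ l, AnalyticAt ℂ (fun v : (Fin N → ℂ) × (Fin N → ℂ) × (Fin N → ℂ) => v.1 l) v :=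
    fun l => analyticAt_pi_iff.mp analyticAt_fst l
  have h2 : ∀ l, AnalyticAt ℂ (fun v : (Fin N → ℂ) × (Fin N → ℂ) × (Fin N → ℂ) => v.2.1 l) v :=
    fun l => analyticAt_pi_iff.mp (analyticAt_fst.comp analyticAt_snd) l
  have h3 : ∀ l, AnalyticAt ℂ (fun v : (Fin N → ℂ) × (Fin N → ℂ) × (Fin N → ℂ) => v.2.2 l) v :=
    fun l => analyticAt_pi_iff.mp (analyticAt_snd.comp analyticAt_snd) l
  unfold affineJet
  split_ifs
  · exact (((h2 _).mul (h1 _)).sub ((h1 _).mul (h2 _))).div ((h1 _).pow 2) (pow_ne_zero 2 hv)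
  · exact (((((h3 _).mul (h1 _)).sub ((h1 _).mul (h3 _))).mul (h1 _)).sub
      ((analyticAt_const.mul (h2 _)).mul (((h2 _).mul (h1 _)).sub ((h1 _).mul (h2 _))))).div
      ((h1 _).pow 3) (pow_ne_zero 3 hv)

/-- An affine chart sees `f` as ratios of components of any lift `c`, so the quotient rule expresses
the derivatives of order one and two through the 2-jet of `c`. This lets a jet differential be read
on the cone. -/
theorem IsLift.jetCoord_eq {c : ℂ → Fin (n + 2) → ℂ} {f : HolomorphicCurve n X.Points}
    (h : X.IsLift c f.toFun) {e : OpenPartialHomeomorph X.Points (Fin n → ℂ)}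
    {i : Fin (n + 2)} {s : Fin n → Fin (n + 2)}
    (hes : ∀ p ∈ e.source, p.1.rep i ≠ 0 ∧ ∀ a, e p a = p.1.rep (s a) / p.1.rep i)
    (h0 : f.toFun 0 ∈ e.source) :
    c 0 i ≠ 0 ∧ e (f.toFun 0) = (fun a => c 0 (s a) / c 0 i) ∧
      ∀ p : Fin 2 × Fin n, f.jetCoord e ((p.1 : ℕ) + 1) p.2 = affineJet i s p (curveJet c) := by
  have hq : ∀ᶠ t in 𝓝 (0 : ℂ), c t i ≠ 0 ∧ ∀ a, e (f.toFun t) a = c t (s a) / c t i := by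
    filter_upwards [h.lifts, f.holomorphic.continuousAt.eventually_mem (e.open_source.mem_nhds h0)]
      with t ⟨h1, h2⟩ h3
    obtain ⟨h4, h5⟩ := hes _ h3
    rw [h2] at h4
    refine ⟨(rep_ne_zero_iff _ _ _).mp h4, fun a => ?_⟩
    rw [h5, h2, rep_div_rep]
  have hi := hq.self_of_nhds.1
  refine ⟨hi, funext hq.self_of_nhds.2, fun p => ?_⟩
  have hcl : ∀ l, AnalyticAt ℂ (fun t => c t l) 0 := analyticAt_pi_iff.mp h.analytic
  have hd1 : ∀ l, (fun t => deriv c t l) =ᶠ[𝓝 0] deriv fun t => c t l := fun l => by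
    filter_upwards [h.analytic.eventually_analyticAt] with t ht
    exact (hasDerivAt_pi.mp ht.differentiableAt.hasDerivAt l).deriv.symm
  have hd2 : ∀ l, deriv (deriv c) 0 l = deriv (deriv fun t => c t l) 0 := fun l => by
    rw [← (hasDerivAt_pi.mp h.analytic.deriv.differentiableAt.hasDerivAt l).deriv]
    exact (hd1 l).deriv_eq
  have heq : (fun t => e (f.toFun t) p.2) =ᶠ[𝓝 0] fun t => c t (s p.2) / c t i :=
    hq.mono fun t ht => ht.2 p.2
  obtain ⟨k, a⟩ := p
  unfold HolomorphicCurve.jetCoord affineJet curveJet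
  fin_cases k
  · simp only [Fin.zero_eta, zero_add, iteratedDeriv_one, if_true]
    rw [heq.deriv_eq]
    refine (deriv_div_eventuallyEq (hcl _) (hcl i) hi).self_of_nhds.trans ?_
    simp only [← (hd1 _).self_of_nhds]
  · simp only [Fin.mk_one, one_ne_zero, if_false]
    rw [iteratedDeriv_succ, iteratedDeriv_one, heq.deriv.deriv_eq, deriv_deriv_div (hcl _) (hcl i) hi,
      hd2, hd2, ← (hd1 _).self_of_nhds, ← (hd1 _).self_of_nhds]

/-- The points of the cone near one lying over an open set of the hypersurface lie over this open
set as well. -/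
theorem eventually_mk_mem {U : Set X.Points} (hU : IsOpen U) {x : Fin (n + 2) → ℂ} (hx : x ≠ 0)
    {p : X.Points} (hp : p.1 = Projectivization.mk ℂ x hx) (hpU : p ∈ U) :
    ∀ᶠ y in 𝓝 x, ∀ (hy : y ≠ 0) (q : X.Points), q.1 = Projectivization.mk ℂ y hy → q ∈ U := by
  obtain ⟨W, hW, rfl⟩ := isOpen_induced_iff.mp hU
  have h1 : IsOpen ((Projectivization.mk' ℂ : {v : Fin (n + 2) → ℂ // v ≠ 0} → _) ⁻¹' W) :=
    hW.preimage (isQuotientMap_projMk (n + 2)).continuous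
  have h2 : IsOpen {v : Fin (n + 2) → ℂ | v ≠ 0} := isOpen_ne
  have h3 := h2.isOpenMap_subtype_val _ h1
  have h4 : x ∈ Subtype.val '' ((Projectivization.mk' ℂ : {v : Fin (n + 2) → ℂ // v ≠ 0} → _) ⁻¹' W) :=
    ⟨⟨x, hx⟩, by rw [Set.mem_preimage, Projectivization.mk'_eq_mk, ← hp]; exact hpU, rfl⟩
  filter_upwards [h3.mem_nhds h4] with y hy hy0 q hq
  obtain ⟨⟨y', hy'⟩, h5, rfl⟩ := hy
  change q.1 ∈ W
  rw [hq]
  exact h5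

/-- A jet differential of order two on the hypersurface, as a function of the 2-jets of the
cone: it is locally the restriction of holomorphic functions of the ambient space of jets. -/
theorem exists_coneJet_function {m : ℕ} {P : JetSpace n X.Points 2 → ℂ}
    (hP : IsJetDifferential 2 m P) :
    ∃ G : (Fin (n + 2) → ℂ) × (Fin (n + 2) → ℂ) × (Fin (n + 2) → ℂ) → ℂ,
      (∀ (c : ℂ → Fin (n + 2) → ℂ) (f : HolomorphicCurve n X.Points), X.IsLift c f.toFun →
        P (f.jet 2) = G (curveJet c)) ∧
      ∀ v, X.IsConeJet v.1 v.2.1 v.2.2 → ∃ H, AnalyticAt ℂ H v ∧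
        ∀ᶠ w in 𝓝 v, X.IsConeJet w.1 w.2.1 w.2.2 → G w = H w := by
  classical
  have hlocal : ∀ p : X.Points, ∃ (e : OpenPartialHomeomorph X.Points (Fin n → ℂ))
      (H : (Fin (n + 2) → ℂ) × (Fin (n + 2) → ℂ) × (Fin (n + 2) → ℂ) → ℂ), p ∈ e.source ∧
      (∀ (c : ℂ → Fin (n + 2) → ℂ) (f : HolomorphicCurve n X.Points), X.IsLift c f.toFun →
        f.toFun 0 ∈ e.source → P (f.jet 2) = H (curveJet c)) ∧
      ∀ (c : ℂ → Fin (n + 2) → ℂ) (f : HolomorphicCurve n X.Points), X.IsLift c f.toFun →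
        f.toFun 0 ∈ e.source → AnalyticAt ℂ H (curveJet c) := by
    intro p
    obtain ⟨e, he, hpe⟩ := X.exists_isAffineChart p
    have hemax : e ∈ IsManifold.maximalAtlas (modelWithCornersSelf ℂ (Fin n → ℂ)) ω X.Points :=
      IsManifold.subset_maximalAtlas he
    obtain ⟨⟨i, s, hes⟩, -⟩ := he
    obtain ⟨Q, hQ1, hQ2, hQ3⟩ := hP e hemax
    -- The monomials run over a finite set independent of the base point: all weights are at least
    -- one, so no exponent exceeds `m`. Thus `H` is a fixed finite sum of products of functions
    -- analytic at the jets in question.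
    refine ⟨e, fun v =>
      ∑ α ∈ Finset.Iic (Finsupp.equivFunOnFinite.symm fun _ : Fin 2 × Fin n => m),
        (Q fun a => v.1 (s a) / v.1 i).coeff α * ∏ p, affineJet i s p v ^ α p, hpe, ?_, ?_⟩
    · intro c f hcf h0
      obtain ⟨-, h1, h2⟩ := hcf.jetCoord_eq hes h0
      rw [hQ3 f h0, eval_eq_sum_Iic_of_isWeightedHomogeneous (fun p => Nat.le_add_left _ _)
        (hQ1 _ (e.map_source h0)), h1]
      simp only [h2]
      rfl
    · intro c f hcf h0
      obtain ⟨hi, h1, -⟩ := hcf.jetCoord_eq hes h0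
      refine Finset.analyticAt_fun_sum _ fun α _ => AnalyticAt.mul ?_
        (Finset.analyticAt_fun_prod _ fun p _ => (analyticAt_affineJet i s p hi).pow _)
      have hcl : ∀ l, AnalyticAt ℂ
          (fun v : (Fin (n + 2) → ℂ) × (Fin (n + 2) → ℂ) × (Fin (n + 2) → ℂ) => v.1 l)
          (curveJet c) :=
        fun l => analyticAt_pi_iff.mp analyticAt_fst l
      have hz : AnalyticAt ℂ
          (fun (v : (Fin (n + 2) → ℂ) × (Fin (n + 2) → ℂ) × (Fin (n + 2) → ℂ)) (a : Fin n) =>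
            v.1 (s a) / v.1 i) (curveJet c) :=
        analyticAt_pi_iff.mpr fun a => (hcl (s a)).div (hcl i) hi
      refine AnalyticAt.comp (g := fun z => (Q z).coeff α) ?_ hz
      have h3 := hQ2 α _ (e.map_source h0)
      rw [h1] at h3
      exact h3
  have hpt : ∀ {c c' : ℂ → Fin (n + 2) → ℂ} {f f' : ℂ → X.Points}, X.IsLift c f →
      X.IsLift c' f' → c 0 = c' 0 → f 0 = f' 0 := by
    intro c c' f f' h h' hcc
    obtain ⟨h1, h2⟩ := h.lifts.self_of_nhds
    obtain ⟨h1', h2'⟩ := h'.lifts.self_of_nhds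
    apply Subtype.ext
    rw [h2, h2']
    congr 1
  -- Equal cone jets have the same base point in the hypersurface, hence can be compared by one
  -- local formula.
  have hwell : ∀ (c c' : ℂ → Fin (n + 2) → ℂ) (f f' : HolomorphicCurve n X.Points),
      X.IsLift c f.toFun → X.IsLift c' f'.toFun → curveJet c = curveJet c' →
      P (f.jet 2) = P (f'.jet 2) := by
    intro c c' f f' h h' hcc
    obtain ⟨e, H, hp, h1, -⟩ := hlocal (f.toFun 0)
    rw [h1 c f h hp, h1 c' f' h' (by rw [← hpt h h' (congrArg Prod.fst hcc)]; exact hp), hcc]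
  let G : (Fin (n + 2) → ℂ) × (Fin (n + 2) → ℂ) × (Fin (n + 2) → ℂ) → ℂ := fun v =>
    if h : ∃ f : HolomorphicCurve n X.Points, ∃ c, X.IsLift c f.toFun ∧ curveJet c = v then
      P (h.choose.jet 2) else 0
  have hG : ∀ (c : ℂ → Fin (n + 2) → ℂ) (f : HolomorphicCurve n X.Points), X.IsLift c f.toFun →
      P (f.jet 2) = G (curveJet c) := by
    intro c f hcf
    have h : ∃ f : HolomorphicCurve n X.Points, ∃ c', X.IsLift c' f.toFun ∧
      curveJet c' = curveJet c := ⟨f, c, hcf, rfl⟩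
    simp only [G]
    rw [dif_pos h]
    obtain ⟨c', h1, h2⟩ := h.choose_spec
    exact hwell c c' f _ hcf h1 h2.symm
  refine ⟨G, hG, fun v hv => ?_⟩
  obtain ⟨c, f, hcf, hc0, hc1, hc2⟩ := hv.exists_isLift
  have hcv : curveJet c = v := Prod.ext hc0 (Prod.ext hc1 hc2)
  obtain ⟨e, H, hp, h1, h2⟩ := hlocal (f.toFun 0)
  refine ⟨H, hcv ▸ h2 c f hcf hp, ?_⟩
  obtain ⟨h3, h4⟩ := hcf.lifts.self_of_nhds
  -- Nearby cone jets project into the same chart, so a single `H` computes `G` on all of them.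
  have h5 := eventually_mk_mem e.open_source h3 h4 hp
  rw [hc0] at h5
  filter_upwards [continuous_fst.continuousAt.eventually h5] with w hw hwJ
  obtain ⟨c', f', hcf', hc0', hc1', hc2'⟩ := hwJ.exists_isLift
  have hcw : curveJet c' = w := Prod.ext hc0' (Prod.ext hc1' hc2')
  obtain ⟨h6, h7⟩ := hcf'.lifts.self_of_nhds
  rw [← hcw, ← hG c' f' hcf']
  exact h1 c' f' hcf' (hw (hc0' ▸ h6) _ (by rw [h7]; congr 1))

end SmoothHypersurface

/-! ### Prolongations along polynomial families -/

section Substitution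

open MvPolynomial

variable {N r : ℕ}

theorem eval_bind₁_eq (g : Fin N → MvPolynomial (Fin r) ℂ) (F : MvPolynomial (Fin N) ℂ)
    (s : Fin r → ℂ) : eval s (bind₁ g F) = eval (fun l => eval s (g l)) F := by
  induction F using MvPolynomial.induction_on with
  | C a => simp
  | add p q hp hq => simp [hp, hq]
  | mul_X p l hp => simp [hp]

theorem pderiv_bind₁_eq (g : Fin N → MvPolynomial (Fin r) ℂ) (F : MvPolynomial (Fin N) ℂ)
    (i : Fin r) : pderiv i (bind₁ g F) = ∑ l, bind₁ g (pderiv l F) * pderiv i (g l) := by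
  induction F using MvPolynomial.induction_on with
  | C a => simp
  | add p q hp hq => simp [hp, hq, add_mul, Finset.sum_add_distrib]
  | mul_X p k hp =>
    simp only [map_mul, bind₁_X_right, Derivation.leibniz, hp, smul_eq_mul, pderiv_X, map_add,
      Pi.single_apply, add_mul, Finset.sum_add_distrib, Finset.mul_sum]
    congr 1
    · simp [apply_ite]
    · exact Finset.sum_congr rfl fun l _ => by ring

/-- The first prolongation of `F` along polynomial families of points and velocities. -/
noncomputable def polyFirstProlongation (F : MvPolynomial (Fin N) ℂ)
    (g h : Fin N → MvPolynomial (Fin r) ℂ) : MvPolynomial (Fin r) ℂ :=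
  ∑ l, bind₁ g (pderiv l F) * h l

/-- The second prolongation of `F` along polynomial families of 2-jets. -/
noncomputable def polySecondProlongation (F : MvPolynomial (Fin N) ℂ)
    (g h k : Fin N → MvPolynomial (Fin r) ℂ) : MvPolynomial (Fin r) ℂ :=
  ∑ l, (polyFirstProlongation (pderiv l F) g h * h l + bind₁ g (pderiv l F) * k l)

theorem eval_polyFirstProlongation (F : MvPolynomial (Fin N) ℂ)
    (g h : Fin N → MvPolynomial (Fin r) ℂ) (s : Fin r → ℂ) :
    eval s (polyFirstProlongation F g h) =
      firstProlongation F (fun l => eval s (g l)) (fun l => eval s (h l)) := by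
  simp [polyFirstProlongation, firstProlongation, eval_bind₁_eq]

theorem eval_polySecondProlongation (F : MvPolynomial (Fin N) ℂ)
    (g h k : Fin N → MvPolynomial (Fin r) ℂ) (s : Fin r → ℂ) :
    eval s (polySecondProlongation F g h k) =
      secondProlongation F (fun l => eval s (g l)) (fun l => eval s (h l))
        (fun l => eval s (k l)) := by
  simp [polySecondProlongation, secondProlongation, eval_polyFirstProlongation, eval_bind₁_eq]

theorem eval_pderiv_bind₁_eq_zero (F : MvPolynomial (Fin N) ℂ)
    {g : Fin N → MvPolynomial (Fin r) ℂ} {i : Fin r} {s : Fin r → ℂ}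
    (hg : ∀ l, eval s (pderiv i (g l)) = 0) : eval s (pderiv i (bind₁ g F)) = 0 := by
  simp [pderiv_bind₁_eq, hg]

theorem eval_pderiv_polyFirstProlongation (F : MvPolynomial (Fin N) ℂ)
    {g h : Fin N → MvPolynomial (Fin r) ℂ} {i : Fin r} {s : Fin r → ℂ}
    (hg : ∀ l, eval s (pderiv i (g l)) = 0) :
    eval s (pderiv i (polyFirstProlongation F g h)) =
      ∑ l, eval (fun l => eval s (g l)) (pderiv l F) * eval s (pderiv i (h l)) := by
  simp [polyFirstProlongation, eval_pderiv_bind₁_eq_zero _ hg, eval_bind₁_eq, Derivation.leibniz]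

/-- If points and velocities are both stationary in the `i`-th parameter, only the term linear in
the accelerations varies. This isolates the last diagonal entry of the Jacobian matrix of
`familyMap`. -/
theorem eval_pderiv_polySecondProlongation (F : MvPolynomial (Fin N) ℂ)
    {g h k : Fin N → MvPolynomial (Fin r) ℂ} {i : Fin r} {s : Fin r → ℂ}
    (hg : ∀ l, eval s (pderiv i (g l)) = 0) (hh : ∀ l, eval s (pderiv i (h l)) = 0) :
    eval s (pderiv i (polySecondProlongation F g h k)) =
      ∑ l, eval (fun l => eval s (g l)) (pderiv l F) * eval s (pderiv i (k l)) := by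
  simp [polySecondProlongation, eval_pderiv_bind₁_eq_zero _ hg,
    eval_pderiv_polyFirstProlongation _ hg, hh, eval_bind₁_eq, Derivation.leibniz]

end Substitution

/-! ### Homogeneity and growth on the cone -/

namespace SmoothHypersurface

open Filter Topology

variable {n d : ℕ} {X : SmoothHypersurface n d}

theorem curveJet_smul_comp_mul {N : ℕ} (c : ℂ → Fin N → ℂ) (a μ : ℂ) :
    curveJet (fun t => a • c (μ * t)) =
      (a • c 0, a • μ • deriv c 0, a • μ ^ 2 • deriv (deriv c) 0) := by
  have h1 : ∀ u : ℂ → Fin N → ℂ, deriv (fun t => u (μ * t)) = fun t => μ • deriv u (μ * t) :=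
    fun u => funext fun t => deriv_comp_mul_left μ u t
  have h2 : ∀ (b : ℂ) (u : ℂ → Fin N → ℂ), deriv (fun t => b • u t) = fun t => b • deriv u t :=
    fun b u => funext fun t => deriv_fun_const_smul_field b u
  unfold curveJet
  rw [h2, h1]
  simp only [h2, h1, mul_zero, smul_smul, pow_two, mul_assoc]

/-- Homogeneity of an invariant jet differential as a function of cone jets. -/
theorem coneJet_function_homogeneous {m : ℕ} {P : JetSpace n X.Points 2 → ℂ}
    (hP : IsReparamInvariant 2 m P)
    {G : (Fin (n + 2) → ℂ) × (Fin (n + 2) → ℂ) × (Fin (n + 2) → ℂ) → ℂ}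
    (hG : ∀ (c : ℂ → Fin (n + 2) → ℂ) (f : HolomorphicCurve n X.Points), X.IsLift c f.toFun →
      P (f.jet 2) = G (curveJet c)) {x y z : Fin (n + 2) → ℂ} (h : X.IsConeJet x y z)
    {a μ : ℂ} (ha : a ≠ 0) (hμ : μ ≠ 0) :
    X.IsConeJet (a • x) (a • μ • y) (a • μ ^ 2 • z) ∧
      G (a • x, a • μ • y, a • μ ^ 2 • z) = μ ^ m * G (x, y, z) := by
  obtain ⟨c, f, hcf, rfl, rfl, rfl⟩ := h.exists_isLift
  have hda : HasDerivAt (fun t : ℂ => μ * t) μ 0 := by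
    simpa using (hasDerivAt_id (0 : ℂ)).const_mul μ
  have hμa : AnalyticAt ℂ (fun t : ℂ => μ * t) 0 := analyticAt_const.mul analyticAt_id
  let φ : Reparametrization :=
    { toFun := fun t => μ * t
      analytic := hμa
      map_zero := mul_zero μ
      deriv_ne_zero := by rw [hda.deriv]; exact hμ }
  have ht : Tendsto (fun t : ℂ => μ * t) (𝓝 0) (𝓝 0) := by
    simpa using hμa.continuousAt.tendsto
  have hlift : X.IsLift (fun t => c (μ * t)) (f.reparam φ).toFun := by
    refine ⟨AnalyticAt.comp (g := c) (by simpa using hcf.analytic) hμa, ?_⟩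
    filter_upwards [ht.eventually hcf.lifts] with t ht'
    exact ht'
  have hlift' := hlift.const_smul ha
  have hjet := curveJet_smul_comp_mul c a μ
  have h1 := hG _ _ hlift'
  rw [hjet, hP f φ, hG c f hcf] at h1
  refine ⟨?_, ?_⟩
  · have h2 := hlift'.isConeJet
    have h3 := congrArg (fun v => v.1) hjet
    have h4 := congrArg (fun v => v.2.1) hjet
    have h5 := congrArg (fun v => v.2.2) hjet
    simp only [curveJet] at h3 h4 h5
    rwa [h3, h4, h5] at h2
  · rw [← h1]
    have : deriv φ.toFun 0 = μ := hda.deriv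
    rw [this]
    rfl

theorem continuous_firstProlongation {N : ℕ} (F : MvPolynomial (Fin N) ℂ) {Y : Type*}
    [TopologicalSpace Y] {x y : Y → Fin N → ℂ} (hx : Continuous x) (hy : Continuous y) :
    Continuous fun v => firstProlongation F (x v) (y v) :=
  continuous_finsetSum _ fun l _ => ((MvPolynomial.continuous_eval _).comp hx).mul
    ((continuous_apply l).comp hy)

theorem continuous_secondProlongation {N : ℕ} (F : MvPolynomial (Fin N) ℂ) {Y : Type*}
    [TopologicalSpace Y] {x y z : Y → Fin N → ℂ} (hx : Continuous x) (hy : Continuous y)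
    (hz : Continuous z) : Continuous fun v => secondProlongation F (x v) (y v) (z v) :=
  continuous_finsetSum _ fun l _ => ((continuous_firstProlongation _ hx hy).mul
    ((continuous_apply l).comp hy)).add
      (((MvPolynomial.continuous_eval _).comp hx).mul ((continuous_apply l).comp hz))

/-- Growth of an invariant jet differential, by compactness and homogeneity. -/
theorem exists_bound_coneJet_function {m : ℕ}
    {G : (Fin (n + 2) → ℂ) × (Fin (n + 2) → ℂ) × (Fin (n + 2) → ℂ) → ℂ}
    (hloc : ∀ v, X.IsConeJet v.1 v.2.1 v.2.2 → ∃ H, AnalyticAt ℂ H v ∧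
        ∀ᶠ w in 𝓝 v, X.IsConeJet w.1 w.2.1 w.2.2 → G w = H w)
    (hhom : ∀ x y z, X.IsConeJet x y z → ∀ a μ : ℂ, a ≠ 0 → μ ≠ 0 →
      X.IsConeJet (a • x) (a • μ • y) (a • μ ^ 2 • z) ∧
      G (a • x, a • μ • y, a • μ ^ 2 • z) = μ ^ m * G (x, y, z)) :
    ∃ M : ℝ, 0 ≤ M ∧ ∀ x y z, X.IsConeJet x y z → ∀ r : ℝ, 0 < r → ‖y‖ ≤ r * ‖x‖ →
      ‖z‖ ≤ r ^ 2 * ‖x‖ → ‖G (x, y, z)‖ ≤ M * r ^ m := by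
  -- The normalization `‖x‖ = 1` keeps jets away from the vertex of the cone, so this bounded set of
  -- cone jets is closed, hence compact.
  let S : Set ((Fin (n + 2) → ℂ) × (Fin (n + 2) → ℂ) × (Fin (n + 2) → ℂ)) :=
    (Metric.closedBall 0 1 ×ˢ Metric.closedBall 0 1 ×ˢ Metric.closedBall 0 1) ∩
      ({v | ‖v.1‖ = 1} ∩ ({v | MvPolynomial.eval v.1 X.poly = 0} ∩
        ({v | firstProlongation X.poly v.1 v.2.1 = 0} ∩
          {v | secondProlongation X.poly v.1 v.2.1 v.2.2 = 0})))
  have hSJ : ∀ v ∈ S, X.IsConeJet v.1 v.2.1 v.2.2 := by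
    rintro v ⟨-, h1, h2, h3, h4⟩
    refine ⟨fun h0 => ?_, h2, h3, h4⟩
    have h1' : ‖v.1‖ = 1 := h1
    rw [h0, norm_zero] at h1'
    exact zero_ne_one h1'
  have hS : IsCompact S := by
    refine IsCompact.inter_right ((isCompact_closedBall _ _).prod
      ((isCompact_closedBall _ _).prod (isCompact_closedBall _ _))) ?_
    have c1 : IsClosed {v : (Fin (n + 2) → ℂ) × (Fin (n + 2) → ℂ) × (Fin (n + 2) → ℂ) |
        ‖v.1‖ = 1} := isClosed_eq continuous_fst.norm continuous_const
    have c2 : IsClosed {v : (Fin (n + 2) → ℂ) × (Fin (n + 2) → ℂ) × (Fin (n + 2) → ℂ) |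
        MvPolynomial.eval v.1 X.poly = 0} :=
      isClosed_eq ((MvPolynomial.continuous_eval X.poly).comp continuous_fst) continuous_const
    have c3 : IsClosed {v : (Fin (n + 2) → ℂ) × (Fin (n + 2) → ℂ) × (Fin (n + 2) → ℂ) |
        firstProlongation X.poly v.1 v.2.1 = 0} :=
      isClosed_eq (continuous_firstProlongation X.poly continuous_fst
        (continuous_fst.comp continuous_snd)) continuous_const
    have c4 : IsClosed {v : (Fin (n + 2) → ℂ) × (Fin (n + 2) → ℂ) × (Fin (n + 2) → ℂ) |
        secondProlongation X.poly v.1 v.2.1 v.2.2 = 0} :=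
      isClosed_eq (continuous_secondProlongation X.poly continuous_fst
        (continuous_fst.comp continuous_snd) (continuous_snd.comp continuous_snd)) continuous_const
    exact c1.inter (c2.inter (c3.inter c4))
  have hcont : ContinuousOn G S := by
    intro v hv
    obtain ⟨H, hH, heq⟩ := hloc v (hSJ v hv)
    refine hH.continuousAt.continuousWithinAt.congr_of_eventuallyEq ?_
      (heq.self_of_nhds (hSJ v hv))
    rw [EventuallyEq, eventually_nhdsWithin_iff]
    exact heq.mono fun w hw hwS => hw (hSJ w hwS)
  obtain ⟨M, hM⟩ := hS.exists_bound_of_continuousOn hcont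
  refine ⟨max M 0, le_max_right _ _, fun x y z hJ r hr hy hz => ?_⟩
  have hx : 0 < ‖x‖ := norm_pos_iff.mpr hJ.1
  -- Scaling by `a = 1/‖x‖` and `μ = 1/r` moves the jet into `S`, at the cost of the factor
  -- `r^{-m}`.
  obtain ⟨h1, h2⟩ := hhom x y z hJ ((‖x‖⁻¹ : ℝ) : ℂ) ((r⁻¹ : ℝ) : ℂ)
    (by simpa using hJ.1) (by simpa using hr.ne')
  have hmem : (((‖x‖⁻¹ : ℝ) : ℂ) • x, ((‖x‖⁻¹ : ℝ) : ℂ) • ((r⁻¹ : ℝ) : ℂ) • y,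
      ((‖x‖⁻¹ : ℝ) : ℂ) • ((r⁻¹ : ℝ) : ℂ) ^ 2 • z) ∈ S := by
    have hn : ‖((‖x‖⁻¹ : ℝ) : ℂ) • x‖ = 1 := by
      rw [norm_smul, Complex.norm_real, Real.norm_eq_abs, abs_of_pos (inv_pos.mpr hx),
        inv_mul_cancel₀ hx.ne']
    refine ⟨⟨?_, ?_, ?_⟩, hn, h1.2.1, h1.2.2.1, h1.2.2.2⟩
    · rw [mem_closedBall_zero_iff]
      exact hn.le
    · rw [mem_closedBall_zero_iff, norm_smul, norm_smul, Complex.norm_real, Complex.norm_real,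
        Real.norm_eq_abs, Real.norm_eq_abs, abs_of_pos (inv_pos.mpr hx),
        abs_of_pos (inv_pos.mpr hr), ← mul_assoc, ← mul_inv, inv_mul_le_iff₀ (by positivity),
        mul_one, mul_comm]
      exact hy
    · rw [mem_closedBall_zero_iff, norm_smul, norm_smul, norm_pow, Complex.norm_real,
        Complex.norm_real,
        Real.norm_eq_abs, Real.norm_eq_abs, abs_of_pos (inv_pos.mpr hx),
        abs_of_pos (inv_pos.mpr hr), ← mul_assoc, inv_pow, ← mul_inv,
        inv_mul_le_iff₀ (by positivity), mul_one, mul_comm]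
      exact hz
  have h3 := (hM _ hmem).trans (le_max_left M 0)
  rw [h2, norm_mul, norm_pow, Complex.norm_real, Real.norm_eq_abs, abs_of_pos (inv_pos.mpr hr),
    inv_pow, inv_mul_le_iff₀ (by positivity), mul_comm] at h3
  exact h3

end SmoothHypersurface

/-! ### The four-parameter family of jets through a given one -/

section CurveFamily

open MvPolynomial

variable {N : ℕ}

/-- The points `x₀ + s₀ e_e + s₁ e_j + s₂² e_a + s₃² e_b`. -/
noncomputable def familyPoint (x₀ : Fin N → ℂ) (e j a b l : Fin N) : MvPolynomial (Fin 4) ℂ :=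
  C (x₀ l) + if l = e then X 0 else if l = j then X 1 else if l = a then X 2 ^ 2 else
    if l = b then X 3 ^ 2 else 0

/-- The vectors `y₀ + s_k e_j`. -/
noncomputable def familyVector (y₀ : Fin N → ℂ) (j : Fin N) (k : Fin 4) (l : Fin N) :
    MvPolynomial (Fin 4) ℂ :=
  C (y₀ l) + if l = j then X k else 0

/-- The equations cutting out a curve in a four-dimensional family of 2-jets, preceded by a
coordinate function. -/
noncomputable def familyMap (F : MvPolynomial (Fin N) ℂ) (x₀ y₀ z₀ : Fin N → ℂ)
    (e j a b : Fin N) : Fin 4 → MvPolynomial (Fin 4) ℂ :=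
  ![X 0, bind₁ (familyPoint x₀ e j a b) F,
    polyFirstProlongation F (familyPoint x₀ e j a b) (familyVector y₀ j 2),
    polySecondProlongation F (familyPoint x₀ e j a b) (familyVector y₀ j 2) (familyVector z₀ j 3)]

theorem eval_zero_familyPoint (x₀ : Fin N → ℂ) (e j a b l : Fin N) :
    eval 0 (familyPoint x₀ e j a b l) = x₀ l := by
  unfold familyPoint
  split_ifs <;> simp

theorem eval_zero_familyVector (y₀ : Fin N → ℂ) (j : Fin N) (k : Fin 4) (l : Fin N) :
    eval 0 (familyVector y₀ j k l) = y₀ l := by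
  unfold familyVector
  split_ifs <;> simp

theorem eval_zero_pderiv_one_familyPoint (x₀ : Fin N → ℂ) {e j a b : Fin N} (hej : e ≠ j)
    (l : Fin N) : eval 0 (pderiv 1 (familyPoint x₀ e j a b l)) = if l = j then 1 else 0 := by
  unfold familyPoint
  split_ifs with h1 h2 <;> simp_all [pderiv_X]

/-- The last two parameters enter the points only through their squares, hence not to first order at
`0`. -/
theorem eval_zero_pderiv_familyPoint (x₀ : Fin N → ℂ) (e j a b : Fin N) {i : Fin 4}
    (h0 : i ≠ 0) (h1 : i ≠ 1) (l : Fin N) :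
    eval 0 (pderiv i (familyPoint x₀ e j a b l)) = 0 := by
  unfold familyPoint
  split_ifs <;> simp [pderiv_X, h0.symm, h1.symm]

theorem eval_zero_pderiv_familyVector (y₀ : Fin N → ℂ) (j : Fin N) (k i : Fin 4) (l : Fin N) :
    eval 0 (pderiv i (familyVector y₀ j k l)) = if i = k ∧ l = j then 1 else 0 := by
  unfold familyVector
  by_cases hi : i = k <;> by_cases hl : l = j <;> simp_all [pderiv_X, Ne.symm]

/-- The matrix is lower triangular at `0`: `s₂` and `s₃` do not move the point to first order, and
`s₃` does not move the velocity. The diagonal is `1` followed by three copies of `∂_j F`, since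
`s₁`, `s₂`, `s₃` move the `j`-th components of point, velocity and acceleration. -/
theorem eval_zero_jacobianDet_familyMap (F : MvPolynomial (Fin N) ℂ) (x₀ y₀ z₀ : Fin N → ℂ)
    {e j a b : Fin N} (hej : e ≠ j) :
    eval 0 (jacobianDet (familyMap F x₀ y₀ z₀ e j a b)) = eval x₀ (pderiv j F) ^ 3 := by
  have hg : (fun l => eval 0 (familyPoint x₀ e j a b l)) = x₀ :=
    funext fun l => eval_zero_familyPoint _ _ _ _ _ _
  have hg2 := eval_zero_pderiv_familyPoint x₀ e j a b (i := 2) (by decide) (by decide)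
  have hg3 := eval_zero_pderiv_familyPoint x₀ e j a b (i := 3) (by decide) (by decide)
  have hh3 : ∀ l, eval 0 (pderiv 3 (familyVector y₀ j 2 l)) = 0 := fun l => by
    simp [-eval_zero, -eval_zero', eval_zero_pderiv_familyVector]
  have h11 : eval 0 (pderiv 1 (bind₁ (familyPoint x₀ e j a b) F)) = eval x₀ (pderiv j F) := by
    simp [-eval_zero, -eval_zero', pderiv_bind₁_eq, eval_bind₁_eq, hg, eval_zero_pderiv_one_familyPoint x₀ hej]
  have h22 : eval 0 (pderiv 2 (polyFirstProlongation F (familyPoint x₀ e j a b)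
      (familyVector y₀ j 2))) = eval x₀ (pderiv j F) := by
    simp [-eval_zero, -eval_zero', eval_pderiv_polyFirstProlongation F hg2, hg, eval_zero_pderiv_familyVector]
  have h33 : eval 0 (pderiv 3 (polySecondProlongation F (familyPoint x₀ e j a b)
      (familyVector y₀ j 2) (familyVector z₀ j 3))) = eval x₀ (pderiv j F) := by
    simp [-eval_zero, -eval_zero', eval_pderiv_polySecondProlongation F hg3 hh3, hg, eval_zero_pderiv_familyVector]
  have h12 := eval_pderiv_bind₁_eq_zero F hg2
  have h13 := eval_pderiv_bind₁_eq_zero F hg3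
  have h23 : eval 0 (pderiv 3 (polyFirstProlongation F (familyPoint x₀ e j a b)
      (familyVector y₀ j 2))) = 0 := by
    simp [-eval_zero, -eval_zero', eval_pderiv_polyFirstProlongation F hg3, hh3]
  rw [eval_jacobianDet, Matrix.det_of_isLowerTriangular]
  · simp [-eval_zero, -eval_zero', Fin.prod_univ_four, familyMap, h11, h22, h33, pow_succ]
  · intro k l hkl
    have hkl' : k < l := hkl
    fin_cases k <;> fin_cases l <;> first | exact absurd hkl' (by decide) | skip
    all_goals simp [-eval_zero, -eval_zero', familyMap, h12, h13, h23, pderiv_X]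

/-- Growth of the members of the family in terms of their base points: at distance `t⁴` the
parameters are `O(t⁴)` and the vectors are `O(t²)`. -/
theorem exists_bound_family (x₀ y₀ z₀ : Fin N → ℂ) {e j a b : Fin N} (hej : e ≠ j) (hae : a ≠ e)
    (haj : a ≠ j) (hbe : b ≠ e) (hbj : b ≠ j) (hba : b ≠ a) :
    ∃ A : ℝ, 1 ≤ A ∧ ∀ (s : Fin 4 → ℂ) (t : ℝ), 1 ≤ t →
      ‖fun l => eval s (familyPoint x₀ e j a b l)‖ ≤ t ^ 4 →
      ‖s‖ ≤ A * t ^ 4 ∧ ‖fun l => eval s (familyVector y₀ j 2 l)‖ ≤ A * t ^ 2 ∧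
        ‖fun l => eval s (familyVector z₀ j 3 l)‖ ≤ A * t ^ 2 := by
  set B : ℝ := 1 + ‖x₀‖ + ‖y₀‖ + ‖z₀‖ with hB
  have hx := norm_nonneg x₀
  have hy := norm_nonneg y₀
  have hz := norm_nonneg z₀
  have hB1 : 1 ≤ B := by linarith
  refine ⟨3 * B, by linarith, fun s t ht hn => ?_⟩
  have ht2 : 1 ≤ t ^ 2 := one_le_pow₀ ht
  have ht4 : t ^ 2 ≤ t ^ 4 := pow_le_pow_right₀ ht (by norm_num)
  -- The four moving coordinates of the point display `s₀`, `s₁`, `s₂²`, `s₃²` directly, so a bound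
  -- on the point bounds every parameter, with a square root gained for the last two.
  have hcoord : ∀ l, ‖eval s (familyPoint x₀ e j a b l) - x₀ l‖ ≤ 2 * B * t ^ 4 := by
    intro l
    have h1 := (norm_le_pi_norm (fun l => eval s (familyPoint x₀ e j a b l)) l).trans hn
    have h2 := norm_le_pi_norm x₀ l
    have h3 := norm_sub_le (eval s (familyPoint x₀ e j a b l)) (x₀ l)
    nlinarith
  have hs0 : ‖s 0‖ ≤ 2 * B * t ^ 4 := by simpa [familyPoint] using hcoord e
  have hs1 : ‖s 1‖ ≤ 2 * B * t ^ 4 := by simpa [familyPoint, hej.symm] using hcoord j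
  have hsq : ∀ u : ℂ, ‖u ^ 2‖ ≤ 2 * B * t ^ 4 → ‖u‖ ≤ 2 * B * t ^ 2 := by
    intro u hu
    rw [norm_pow] at hu
    refine abs_le_of_sq_le_sq' ?_ (by positivity) |>.2
    refine hu.trans ?_
    have : (2 * B * t ^ 2) ^ 2 = 2 * B * t ^ 4 * (2 * B) := by ring
    rw [this]
    exact le_mul_of_one_le_right (by positivity) (by linarith)
  have hs2 : ‖s 2‖ ≤ 2 * B * t ^ 2 :=
    hsq _ (by simpa [familyPoint, hae, haj] using hcoord a)
  have hs3 : ‖s 3‖ ≤ 2 * B * t ^ 2 :=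
    hsq _ (by simpa [familyPoint, hbe, hbj, hba] using hcoord b)
  have hvec : ∀ (w : Fin N → ℂ) (k : Fin 4), ‖w‖ ≤ B → ‖s k‖ ≤ 2 * B * t ^ 2 →
      ‖fun l => eval s (familyVector w j k l)‖ ≤ 3 * B * t ^ 2 := by
    intro w k hw hk
    refine (pi_norm_le_iff_of_nonneg (by positivity)).mpr fun l => ?_
    have h1 : ‖eval s (familyVector w j k l)‖ ≤ ‖w l‖ + ‖s k‖ := by
      unfold familyVector
      split_ifs
      · simpa using norm_add_le (w l) (s k)
      · simp
    have h2 := norm_le_pi_norm w l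
    nlinarith
  refine ⟨(pi_norm_le_iff_of_nonneg (by positivity)).mpr fun l => ?_,
    hvec y₀ 2 (by linarith) hs2, hvec z₀ 3 (by linarith) hs3⟩
  have h5 : 2 * B * t ^ 4 ≤ 3 * B * t ^ 4 := by nlinarith
  have h6 : 2 * B * t ^ 2 ≤ 2 * B * t ^ 4 := by nlinarith
  fin_cases l
  · exact hs0.trans h5
  · exact hs1.trans h5
  · exact (hs2.trans h6).trans h5
  · exact (hs3.trans h6).trans h5

end CurveFamily

/-! ### Vanishing on the cone over a threefold -/

/-- Dimension three enters here: besides `i` and `j` there remain a free direction `e` and one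
square direction for each of the two orders of differentiation. -/
theorem exists_three_others : ∀ i j : Fin (3 + 2), j ≠ i → ∃ e a b : Fin (3 + 2),
    e ≠ j ∧ a ≠ e ∧ a ≠ j ∧ b ≠ e ∧ b ≠ j ∧ b ≠ a ∧ i ≠ e ∧ i ≠ a ∧ i ≠ b := by
  decide

namespace SmoothHypersurface

open Filter Topology

variable {d : ℕ} {X : SmoothHypersurface 3 d}

/-- A bounded homogeneous function of positive weight on the 2-jets of the cone over a threefold,
locally the restriction of holomorphic functions, vanishes. -/
theorem coneJet_function_eq_zero {m : ℕ} (hm : 1 ≤ m)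
    {G : (Fin (3 + 2) → ℂ) × (Fin (3 + 2) → ℂ) × (Fin (3 + 2) → ℂ) → ℂ}
    (hloc : ∀ v, X.IsConeJet v.1 v.2.1 v.2.2 → ∃ H, AnalyticAt ℂ H v ∧
        ∀ᶠ w in 𝓝 v, X.IsConeJet w.1 w.2.1 w.2.2 → G w = H w)
    {M : ℝ} (hM0 : 0 ≤ M) (hM : ∀ x y z, X.IsConeJet x y z → ∀ r : ℝ, 0 < r → ‖y‖ ≤ r * ‖x‖ →
      ‖z‖ ≤ r ^ 2 * ‖x‖ → ‖G (x, y, z)‖ ≤ M * r ^ m)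
    {x₀ y₀ z₀ : Fin (3 + 2) → ℂ} (hJ : X.IsConeJet x₀ y₀ z₀) : G (x₀, y₀, z₀) = 0 := by
  obtain ⟨hx0, hF0, hF1, hF2⟩ := hJ
  obtain ⟨i, hi⟩ : ∃ i, x₀ i ≠ 0 := Function.ne_iff.mp hx0
  -- If only the `i`-th partial derivative were nonzero, Euler's relation would give `x_i ∂_i F = 0`
  -- on the cone, although both factors are nonzero.
  obtain ⟨j, hji, hj⟩ : ∃ j, j ≠ i ∧ MvPolynomial.eval x₀ (MvPolynomial.pderiv j X.poly) ≠ 0 := by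
    by_contra! hcon
    obtain ⟨j, hj⟩ := X.smooth x₀ hx0 hF0
    have hji : j = i := by
      by_contra h
      exact hj (hcon j h)
    subst hji
    have hE := congrArg (MvPolynomial.eval x₀) X.homogeneous.sum_X_mul_pderiv
    simp only [map_sum, map_mul, MvPolynomial.eval_X, map_nsmul, hF0, smul_zero] at hE
    rw [Finset.sum_eq_single j (fun l _ hl => by rw [hcon l hl, mul_zero]) (by simp)] at hE
    exact (mul_ne_zero hi hj) hE
  obtain ⟨e, a, b, hej, hae, haj, hbe, hbj, hba, hie, hia, hib⟩ : ∃ e a b : Fin (3 + 2),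
      e ≠ j ∧ a ≠ e ∧ a ≠ j ∧ b ≠ e ∧ b ≠ j ∧ b ≠ a ∧ i ≠ e ∧ i ≠ a ∧ i ≠ b := by
    exact exists_three_others i j hji
  let x : (Fin 4 → ℂ) → Fin (3 + 2) → ℂ := fun s l =>
    MvPolynomial.eval s (familyPoint x₀ e j a b l)
  let y : (Fin 4 → ℂ) → Fin (3 + 2) → ℂ := fun s l => MvPolynomial.eval s (familyVector y₀ j 2 l)
  let z : (Fin 4 → ℂ) → Fin (3 + 2) → ℂ := fun s l => MvPolynomial.eval s (familyVector z₀ j 3 l)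
  set Φ := familyMap X.poly x₀ y₀ z₀ e j a b with hΦ
  have hx : x 0 = x₀ := funext fun l => eval_zero_familyPoint _ _ _ _ _ _
  have hy : y 0 = y₀ := funext fun l => eval_zero_familyVector _ _ _ _
  have hz : z 0 = z₀ := funext fun l => eval_zero_familyVector _ _ _ _
  have hV : ∀ s, (∀ k, k ≠ 0 → MvPolynomial.eval s (Φ k) = 0) ↔ X.IsConeJet (x s) (y s) (z s) := by
    intro s
    have e1 : MvPolynomial.eval s (Φ 1) = MvPolynomial.eval (x s) X.poly := eval_bind₁_eq _ _ _
    have e2 : MvPolynomial.eval s (Φ 2) = firstProlongation X.poly (x s) (y s) :=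
      eval_polyFirstProlongation _ _ _ _
    have e3 : MvPolynomial.eval s (Φ 3) = secondProlongation X.poly (x s) (y s) (z s) :=
      eval_polySecondProlongation _ _ _ _ _
    constructor
    · intro h
      -- The family does not move the `i`-th coordinate, so the point never reaches the vertex of
      -- the cone.
      refine ⟨fun h0 => hi ?_, e1 ▸ h 1 (by decide), e2 ▸ h 2 (by decide), e3 ▸ h 3 (by decide)⟩
      have := congrFun h0 i
      simpa [x, familyPoint, hie, hji.symm, hia, hib] using this
    · rintro ⟨-, h1, h2, h3⟩ k hk
      fin_cases k
      · exact absurd rfl hk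
      · exact e1.trans h1
      · exact e2.trans h2
      · exact e3.trans h3
  have hJa : ∀ s, AnalyticAt ℂ (fun s => (x s, y s, z s)) s := by
    have hp : ∀ (p : Fin (3 + 2) → MvPolynomial (Fin 4) ℂ) (s : Fin 4 → ℂ),
        AnalyticAt ℂ (fun s l => MvPolynomial.eval s (p l)) s := fun p s =>
      analyticAt_pi_iff.mpr fun l => AnalyticOnNhd.eval_mvPolynomial (p l) s trivial
    exact fun s => (hp _ s).prod ((hp _ s).prod (hp _ s))
  obtain ⟨A, hA1, hA⟩ := exists_bound_family x₀ y₀ z₀ hej hae haj hbe hbj hba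
  obtain ⟨C, D, hC, hq⟩ := exists_norm_eval_le (jacobianDet Φ)
  -- The Jacobian is `O(t^{4D})` because the parameters are `O(t⁴)`, while `G = O(1/t)`; the
  -- exponent `4D + 1` leaves a decay of `1/t`.
  have key := eq_zero_of_tendsto_zero_on_curve Φ 0
    (fun s => G (x s, y s, z s) ^ (4 * D + 1) * MvPolynomial.eval s (jacobianDet Φ))
    ?_ ?_ ?_ 0 ?_
  · have hq0 : MvPolynomial.eval 0 (jacobianDet Φ) ≠ 0 := by
      rw [hΦ, eval_zero_jacobianDet_familyMap _ _ _ _ hej]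
      exact pow_ne_zero 3 hj
    rw [hx, hy, hz] at key
    exact pow_eq_zero_iff (Nat.succ_ne_zero _) |>.mp ((mul_eq_zero.mp key).resolve_right hq0)
  · intro s hs
    obtain ⟨H, hH, heq⟩ := hloc (x s, y s, z s) ((hV s).mp hs)
    refine ⟨fun s => H (x s, y s, z s) ^ (4 * D + 1) * MvPolynomial.eval s (jacobianDet Φ),
      ((AnalyticAt.comp (g := H) (f := fun s => (x s, y s, z s)) hH (hJa s)).pow _).mul
        (AnalyticOnNhd.eval_mvPolynomial _ s trivial), ?_⟩
    filter_upwards [(hJa s).continuousAt.eventually heq] with w hw hwV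
    rw [hw ((hV w).mp hwV)]
  · intro s _ h0
    rw [h0, mul_zero]
  · intro ε hε
    set K : ℝ := (M * A ^ m) ^ (4 * D + 1) * (C * (1 + A) ^ D) with hK
    have hK0 : 0 ≤ K := by positivity
    set T : ℝ := 1 + K / ε with hT
    have hT1 : 1 ≤ T := by
      have : 0 ≤ K / ε := by positivity
      linarith
    -- Since `‖s‖ ≤ A t⁴`, this radius forces `t > T > K / ε`, and the final bound `K / t` falls
    -- below `ε`.
    refine ⟨A * T ^ 4, fun s hs hlt => ?_⟩
    have hJs := (hV s).mp hs
    -- The maximum with `1` secures `t ≥ 1` for the growth bounds; afterwards `t > 1` shows that it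
    -- was `‖x s‖` all along.
    set t : ℝ := √√(max ‖x s‖ 1) with ht
    have ht4 : t ^ 4 = max ‖x s‖ 1 := by
      have h1 : (0 : ℝ) ≤ max ‖x s‖ 1 := le_max_of_le_right zero_le_one
      have : t ^ 4 = (t ^ 2) ^ 2 := by ring
      rw [this, ht, Real.sq_sqrt (Real.sqrt_nonneg _), Real.sq_sqrt h1]
    have ht1 : 1 ≤ t := by
      rw [ht, Real.one_le_sqrt, Real.one_le_sqrt]
      exact le_max_right _ _
    have ht0 : 0 < t := by linarith
    obtain ⟨b1, b2, b3⟩ := hA s t ht1 (by rw [ht4]; exact le_max_left _ _)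
    have hTt : T < t := by
      have h1 : T ^ 4 < t ^ 4 := lt_of_mul_lt_mul_left (hlt.trans_le b1) (by linarith)
      exact lt_of_pow_lt_pow_left₀ 4 ht0.le h1
    have hxn : ‖x s‖ = t ^ 4 := by
      have h1 : 1 < t ^ 4 := one_lt_pow₀ (hT1.trans_lt hTt) (by norm_num)
      rw [ht4] at h1 ⊢
      rcases max_choice ‖x s‖ 1 with h | h
      · exact h.symm
      · rw [h] at h1
        exact absurd h1 (lt_irrefl _)
    -- The acceleration dictates this rate: `A t² ≤ (A / t)² t⁴` because `A ≥ 1`, while the velocity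
    -- has a factor `t` to spare.
    have hG := hM _ _ _ hJs (A / t) (by positivity)
      (by
        rw [hxn]
        refine b2.trans ?_
        have : A / t * t ^ 4 = A * t ^ 3 := by field_simp
        rw [this]
        exact mul_le_mul_of_nonneg_left (pow_le_pow_right₀ ht1 (by norm_num)) (by linarith))
      (by
        rw [hxn]
        refine b3.trans ?_
        have : (A / t) ^ 2 * t ^ 4 = A * (A * t ^ 2) := by field_simp
        rw [this]
        exact le_mul_of_one_le_left (by positivity) hA1)
    have hG' : ‖G (x s, y s, z s)‖ ≤ M * A ^ m / t := by
      refine hG.trans ?_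
      rw [div_pow, mul_div_assoc]
      refine mul_le_mul_of_nonneg_left ?_ hM0
      refine div_le_div_of_nonneg_left (by positivity) ht0 ?_
      exact le_self_pow₀ ht1 (by omega)
    have hqs : ‖MvPolynomial.eval s (jacobianDet Φ)‖ ≤ C * (1 + A) ^ D * t ^ (4 * D) := by
      refine (hq s).trans ?_
      rw [mul_assoc, pow_mul, ← mul_pow]
      refine mul_le_mul_of_nonneg_left (pow_le_pow_left₀ (by positivity) ?_ D) hC
      have h1 : (1 : ℝ) ≤ t ^ 4 := one_le_pow₀ ht1
      rw [add_mul, one_mul]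
      exact add_le_add h1 b1
    rw [norm_mul, norm_pow]
    calc ‖G (x s, y s, z s)‖ ^ (4 * D + 1) * ‖MvPolynomial.eval s (jacobianDet Φ)‖
        ≤ (M * A ^ m / t) ^ (4 * D + 1) * (C * (1 + A) ^ D * t ^ (4 * D)) :=
          mul_le_mul (pow_le_pow_left₀ (norm_nonneg _) hG' _) hqs (norm_nonneg _) (by positivity)
      _ = K / t := by
          rw [hK, div_pow, pow_succ t (4 * D)]
          field_simp
      _ < ε := by
          rw [div_lt_iff₀ ht0]
          have h1 : K / ε < t := by linarith
          rw [div_lt_iff₀ hε] at h1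
          linarith
  · rw [hV, hx, hy, hz]
    exact ⟨hx0, hF0, hF1, hF2⟩

end SmoothHypersurface

theorem mainTheorem5 (d : ℕ) (hd : 2 ≤ d) (X : SmoothHypersurface 3 d) (m : ℕ) (hm : 1 ≤ m) :
    globalJetDifferentials 3 X.Points 2 m = ⊥ := by
  rw [eq_bot_iff]
  rintro P ⟨hP, hPinv⟩
  rw [Submodule.mem_bot]
  obtain ⟨G, hG, hloc⟩ := SmoothHypersurface.exists_coneJet_function hP
  obtain ⟨M, hM0, hM⟩ := SmoothHypersurface.exists_bound_coneJet_function hloc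
    fun x y z h a μ ha hμ => SmoothHypersurface.coneJet_function_homogeneous hPinv hG h ha hμ
  funext J
  obtain ⟨f, rfl⟩ := Quotient.exists_rep J
  obtain ⟨c, hc⟩ := SmoothHypersurface.exists_isLift f
  exact (hG c f hc).trans
    (SmoothHypersurface.coneJet_function_eq_zero hm hloc hM0 hM hc.isConeJet)
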